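/- Let $n\ge 1$ and let $\nu$ be a measure on $(0,\infty)$ with $\nu((0,\infty))=\infty$ and $\int_0^\infty (1\wedge x)\,\nu(dx)<\infty$. Let $\{J_\ell\}_{\ell\in\mathbb N}$ be a measurable enumeration of the points of a Poisson point process on $(0,\infty)$ with intensity measure $\nu$, and let $\{Y_{\ell,k}\}_{\ell\in\mathbb N,\,1\le k\le n}$ be independent random variables, independent of $\{J_\ell\}$, where $Y_{\ell,k}$ is $1$-Fréchet with scale $\sigma_k\in(0,\infty)$, that is, $\mathbb P(Y_{\ell,k}\le x)=e^{-\sigma_k/x}$ for $x>0$. The vector $\left(\bigvee_{\ell} J_\ell Y_{\ell,1},\dots,\bigvee_{\ell} J_\ell Y_{\ell,n}\right)$ is called sub-Fréchet max-i.d. with Lévy measure $\nu$. Its hitting partition $\Pi_n$ is the random partition of $[n]=\{1,\dots,n\}$ in which $i$ and $j$ are in the same block if and only if $\ell^*(i)=\ell^*(j)$, where $\ell^*(k)=\operatorname{argmax}_{\ell}J_\ell Y_{\ell,k}$. For $0\le\alpha<1$ and $\theta>-\alpha$, a $\mathrm{PD}(\alpha,\theta)$ partition of $[n]$ is a random partition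 with the law of the following one: let $W_1,W_2,\dots$ be independent with $W_\ell\sim\mathrm{Beta}(1-\alpha,\theta+\ell\alpha)$, let $P_\ell=W_\ell\prod_{i<\ell}(1-W_i)$ (the Poisson--Dirichlet frequencies in size-biased order), given $(P_\ell)$ let $X_1,\dots,X_n$ be i.i.d. with $\mathbb P(X_i=\ell\mid (P_m)_m)=P_\ell$, and put $i$ and $j$ in the same block if and only if $X_i=X_j$. Then the following hold. (i) If $\nu(dw)=\alpha w^{-\alpha-1}\,dw$ with $\alpha\in(0,1)$ (the $\alpha$-logistic max-stable model), then almost surely every $\ell^*(k)$ is uniquely determined, and $\Pi_n$ is a $\mathrm{PD}(\alpha,0)$ partition of $[n]$. (ii) If $\nu(dw)=\theta w^{-1}e^{-w}\,dw$ with $\theta>0$ (the Lévy measure of a Gamma subordinator), then almost surely every $\ell^*(k)$ is uniquely determined, and $\Pi_n$ is a $\mathrm{PD}(0,\theta)$ partition of $[n]$. Moreover, with $(\alpha,\theta)=(\alpha,0)$ in case (i) and $(\alpha,\theta)=(0,\theta)$ in case (ii), for every partition $\pi$ of $[n]$ with block sizes $n_1,\dots,n_k$, $$\mathbb P(\Pi_n=\pi)=\frac{(\theta+\alpha)_{k-1\uparrow\alpha}\,\prod_{i=1}^k(1-\alpha)_{n_i-1\uparrow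 1}}{(\theta+1)_{n-1\uparrow 1}},\qquad (x)_{m\uparrow a}:=\prod_{i=0}^{m-1}(x+ia).$$ -/

import Mathlib

open MeasureTheory ProbabilityTheory
open scoped ENNReal

noncomputable section

namespace HittingPartition

/-! ### Poisson point processes, Fréchet variables and the sub-Fréchet model -/

/-- The Poisson law on `[0, ∞]` with mean `m ∈ [0, ∞]`; for `m = ∞` it is the point mass at `∞`. -/
def poissonLaw (m : ℝ≥0∞) : Measure ℝ≥0∞ :=
  if m = ∞ then Measure.dirac ∞ else (poissonMeasure m.toNNReal).map (fun k : ℕ => (k : ℝ≥0∞))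

/-- The number of indices `ℓ` with `J ℓ ω ∈ A`, i.e. the mass that the point configuration
`∑_ℓ δ_{J ℓ ω}` gives to `A`. -/
def pointCount {Ω : Type*} (J : ℕ → Ω → ℝ) (A : Set ℝ) (ω : Ω) : ℝ≥0∞ :=
  ∑' ℓ, A.indicator (fun _ => (1 : ℝ≥0∞)) (J ℓ ω)

/-- `J` is a measurable enumeration of the points of a Poisson point process with
intensity measure `ν`. -/
structure IsPoissonEnumeration {Ω : Type*} [MeasurableSpace Ω] (ν : Measure ℝ)
    (J : ℕ → Ω → ℝ) (P : Measure Ω) : Prop where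
  measurable : ∀ ℓ, Measurable (J ℓ)
  hasLaw_count : ∀ A : Set ℝ, MeasurableSet A → HasLaw (pointCount J A) (poissonLaw (ν A)) P
  indep_count : ∀ (m : ℕ) (A : Fin m → Set ℝ), (∀ i, MeasurableSet (A i)) →
    Pairwise (Function.onFun Disjoint A) → iIndepFun (fun i => pointCount J (A i)) P

/-- `X` is a `1`-Fréchet random variable with scale `σ`: `P(X ≤ x) = exp(-σ / x)` for `x > 0`. -/
def IsOneFrechet {Ω : Type*} [MeasurableSpace Ω] (σ : ℝ) (X : Ω → ℝ) (P : Measure Ω) : Prop :=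
  Measurable X ∧ ∀ x : ℝ, 0 < x → P.real {ω | X ω ≤ x} = Real.exp (-σ / x)

/-- The data of the sub-Fréchet max-i.d. vector `ζ_k = ⋁_ℓ J_ℓ Y_{ℓ,k}` with Lévy measure `ν`:
`J` enumerates a Poisson point process with intensity `ν`, all the `Y_{ℓ,k}` are independent,
`Y_{ℓ,k}` is `1`-Fréchet with scale `σ_k > 0`, and the family `Y` is independent of `J`. -/
structure IsSubFrechetModel {Ω : Type*} [MeasurableSpace Ω] {n : ℕ} (ν : Measure ℝ)
    (σ : Fin n → ℝ) (J : ℕ → Ω → ℝ) (Y : ℕ → Fin n → Ω → ℝ) (P : Measure Ω) : Prop where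
  scale_pos : ∀ k, 0 < σ k
  poisson : IsPoissonEnumeration ν J P
  frechet : ∀ ℓ k, IsOneFrechet (σ k) (Y ℓ k) P
  indep_marks : iIndepFun (fun p : ℕ × Fin n => Y p.1 p.2) P
  indep_points_marks :
    IndepFun (fun ω (ℓ : ℕ) => J ℓ ω) (fun ω (p : ℕ × Fin n) => Y p.1 p.2 ω) P

/-- The measure `α w^{-α-1} dw` on `(0, ∞)`. -/
def stableLevyMeasure (α : ℝ) : Measure ℝ :=
  (volume.restrict (Set.Ioi 0)).withDensity (fun w => ENNReal.ofReal (α * w ^ (-α - 1)))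

/-- The measure `θ w^{-1} e^{-w} dw` on `(0, ∞)`. -/
def gammaLevyMeasure (θ : ℝ) : Measure ℝ :=
  (volume.restrict (Set.Ioi 0)).withDensity (fun w => ENNReal.ofReal (θ * w⁻¹ * Real.exp (-w)))

/-! ### Hitting partitions -/

/-- The partition of `[n]` in which `i` and `j` are in the same block iff `f i = f j`. -/
def levelPartition {n : ℕ} (f : Fin n → ℕ) : Finpartition (Finset.univ : Finset (Fin n)) :=
  letI : DecidableRel (Setoid.ker f).r := fun i j => inferInstanceAs (Decidable (f i = f j))
  Finpartition.ofSetoid (Setoid.ker f)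

/-- The index `ℓ` maximises `m ↦ J_m Y_{m,k}` at the outcome `ω`. -/
def IsMaximizer {Ω : Type*} {n : ℕ} (J : ℕ → Ω → ℝ) (Y : ℕ → Fin n → Ω → ℝ) (ω : Ω) (k : Fin n)
    (ℓ : ℕ) : Prop :=
  ∀ m, J m ω * Y m k ω ≤ J ℓ ω * Y ℓ k ω

/-- `ℓ*(k) = argmax_ℓ J_ℓ Y_{ℓ,k}`. In the null event that the maximiser is not unique it is taken
to be the least maximiser if there is one, and `0` otherwise. -/
def argmaxIndex {Ω : Type*} {n : ℕ} (J : ℕ → Ω → ℝ) (Y : ℕ → Fin n → Ω → ℝ) (ω : Ω)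
    (k : Fin n) : ℕ :=
  sInf {ℓ | IsMaximizer J Y ω k ℓ}

/-- The hitting partition of `[n]`: `i ∼ j` iff `ℓ*(i) = ℓ*(j)`. -/
def hittingPartition {Ω : Type*} {n : ℕ} (J : ℕ → Ω → ℝ) (Y : ℕ → Fin n → Ω → ℝ) (ω : Ω) :
    Finpartition (Finset.univ : Finset (Fin n)) :=
  levelPartition (argmaxIndex J Y ω)

/-! ### Poisson–Dirichlet partitions -/

/-- The law on `ℕ` with weights `s`. -/
def weightLaw (s : ℕ → ℝ) : Measure ℕ :=
  Measure.sum fun ℓ => ENNReal.ofReal (s ℓ) • Measure.dirac ℓ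

/-- The probability that the paintbox partition of `[n]` with (dust-free) weights `s` equals `π`:
`X_1, …, X_n` are i.i.d. with `P(X_i = ℓ) = s ℓ`, and `i ∼ j` iff `X_i = X_j`. -/
def paintboxProb {n : ℕ} (s : ℕ → ℝ) (π : Finpartition (Finset.univ : Finset (Fin n))) : ℝ≥0∞ :=
  Measure.pi (fun _ : Fin n => weightLaw s) {x | levelPartition x = π}

/-- Stick-breaking: `(W_0, (1 - W_0) W_1, (1 - W_0) (1 - W_1) W_2, …)`. -/
def stickBreaking (W : ℕ → ℝ) (ℓ : ℕ) : ℝ :=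
  W ℓ * ∏ i ∈ Finset.range ℓ, (1 - W i)

/-- The joint law of independent `W_ℓ ∼ Beta(1 - α, θ + (ℓ + 1) α)`, `ℓ = 0, 1, 2, …`. -/
def stickLaw (α θ : ℝ) : Measure (ℕ → ℝ) :=
  Measure.infinitePi fun ℓ : ℕ => betaMeasure (1 - α) (θ + (ℓ + 1) * α)

/-- The probability that the partition of `[n]` induced by the Poisson–Dirichlet distribution
`PD(α, θ)` (`0 ≤ α < 1`, `θ > -α`) equals `π`. This is the paintbox partition whose random weights
are the `PD(α, θ)` frequencies, taken here in size-biased (GEM) order; the order in which the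
frequencies are listed does not affect the paintbox partition. -/
def pdPartitionProb {n : ℕ} (α θ : ℝ) (π : Finpartition (Finset.univ : Finset (Fin n))) : ℝ≥0∞ :=
  ∫⁻ W, paintboxProb (stickBreaking W) π ∂(stickLaw α θ)

/-- The random partition `Q` of `[n]` is a `PD(α, θ)` partition. -/
def IsPDPartition {Ω : Type*} [MeasurableSpace Ω] {n : ℕ} (α θ : ℝ)
    (Q : Ω → Finpartition (Finset.univ : Finset (Fin n))) (P : Measure Ω) : Prop :=
  ∀ π, P {ω | Q ω = π} = pdPartitionProb α θ π

/-- `(x)_{m ↑ a} = ∏_{i < m} (x + i a)`. -/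
def risingFactorial (x : ℝ) (m : ℕ) (a : ℝ) : ℝ :=
  ∏ i ∈ Finset.range m, (x + i * a)

/-- Pitman's formula: for a partition `π` of `[n]` with blocks of sizes `n_1, …, n_k`,
`(θ + α)_{k-1 ↑ α} ∏_i (1 - α)_{n_i - 1 ↑ 1} / (θ + 1)_{n-1 ↑ 1}`. -/
def pitmanFormula {n : ℕ} (α θ : ℝ) (π : Finpartition (Finset.univ : Finset (Fin n))) : ℝ :=
  risingFactorial (θ + α) (π.parts.card - 1) α *
      (∏ b ∈ π.parts, risingFactorial (1 - α) (b.card - 1) 1) /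
    risingFactorial (θ + 1) (n - 1) 1

end HittingPartition

end

/-!
Fix the points `J_ℓ` and suppose that their sum `T` is finite. By the Fréchet race
(`measure_forall_lt`, `ae_exists_forall_lt`), for each coordinate `k` almost surely exactly one
index maximises `J_ℓ Y_{ℓ,k}`, and it equals `ℓ` with probability `J_ℓ / T`. The coordinates are
independent, so given the points the hitting partition is the paintbox partition with weights
`J_ℓ / T`. The probability that such a partition has prescribed blocks of sizes `c_1, …, c_k` is the
sum of `∏ i, (J_{e i} / T) ^ c_i` over tuples `e` of distinct indices, called `distinctSum` below
(`measure_levelPartition_eq`). The claim thus reduces to the computation of the expectation of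
this sum, for the normalised Poisson points and for the Poisson–Dirichlet frequencies. Both turn
out to be the Ewens–Pitman weight `pitmanWeight`.

*Poisson points.* The factor `T ^ (-n)` is linearised by writing it as
`∫ s^{n-1} e^{-sT} ds / Γ(n)`, and the expectation of the remaining sum of products times `e^{-sT}` is given by the
multivariate Mecke formula for powers, `IsPoissonEnumeration.lintegral_distinctSum_mul_expNeg`.
The latter is proved from the Laplace functional by differentiating it one index at a time:
multiplying a distinct-index sum by a power sum gives one more distinct index or merges the new
index with an old one (`distinctSum_cons_add`). For the stable and the gamma Lévy measures the
integral over `s` is a Gamma or a beta integral, see `lintegral_distinctSum_stable` and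
`lintegral_distinctSum_gamma`. With the convention `∞⁻¹ = 0` these identities do not presuppose
that `T` is finite; for a single block of size one they say that `T⁻¹ T` has expectation `1`,
which gives `T < ∞` almost surely.

*Poisson–Dirichlet frequencies.* Conditioning on the first stick gives a recursion
(`stickMoment_succ`) that expresses the expectations for `(α, θ)` by those for `(α, θ + α)`, with
the same composition or with one part removed. The Ewens–Pitman weights satisfy the same recursion
(`pitmanWeight_succ`). By induction on the number of parts, the difference of the two solutions is
multiplied at each step by the coefficient of the same composition; along `θ, θ + α, θ + 2α, …`
these coefficients have infinite product `0`, and the difference is bounded, so it vanishes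
(`stickMoment_eq`).
-/

noncomputable section

namespace HittingPartition

open Filter Topology

/-! ### The function `x ↦ e⁻ˣ` on `[0, ∞]` -/

/-- The function `x ↦ e⁻ˣ` on `[0, ∞]`, with `e^{-∞} = 0`. -/
def expNeg (x : ℝ≥0∞) : ℝ≥0∞ := (EReal.exp (x : EReal))⁻¹

@[simp] lemma expNeg_zero : expNeg 0 = 1 := by simp [expNeg]

@[simp] lemma expNeg_top : expNeg ∞ = 0 := by simp [expNeg]

lemma expNeg_ofReal {x : ℝ} (hx : 0 ≤ x) :
    expNeg (ENNReal.ofReal x) = ENNReal.ofReal (Real.exp (-x)) := by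
  rw [expNeg, EReal.coe_ennreal_ofReal, max_eq_left hx, EReal.exp_coe,
    ← ENNReal.ofReal_inv_of_pos (Real.exp_pos x), Real.exp_neg]

lemma expNeg_eq_ofReal {x : ℝ≥0∞} (hx : x ≠ ∞) :
    expNeg x = ENNReal.ofReal (Real.exp (-x.toReal)) := by
  conv_lhs => rw [← ENNReal.ofReal_toReal hx]
  exact expNeg_ofReal ENNReal.toReal_nonneg

lemma antitone_expNeg : Antitone expNeg := fun _ _ h =>
  ENNReal.inv_le_inv.2 (EReal.exp_monotone (by exact_mod_cast h))

lemma expNeg_le_one (x : ℝ≥0∞) : expNeg x ≤ 1 := by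
  simpa using antitone_expNeg (zero_le (a := x))

lemma expNeg_ne_top (x : ℝ≥0∞) : expNeg x ≠ ∞ := ((expNeg_le_one x).trans_lt ENNReal.one_lt_top).ne

lemma expNeg_add (x y : ℝ≥0∞) : expNeg (x + y) = expNeg x * expNeg y := by
  rcases eq_or_ne x ∞ with rfl | hx
  · simp
  rcases eq_or_ne y ∞ with rfl | hy
  · simp
  rw [expNeg_eq_ofReal hx, expNeg_eq_ofReal hy, expNeg_eq_ofReal (by simp [hx, hy]),
    ← ENNReal.ofReal_mul (Real.exp_pos _).le, ENNReal.toReal_add hx hy, neg_add, Real.exp_add]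

lemma expNeg_sum {ι : Type*} (s : Finset ι) (f : ι → ℝ≥0∞) :
    expNeg (∑ i ∈ s, f i) = ∏ i ∈ s, expNeg (f i) := by
  classical
  induction s using Finset.induction_on with
  | empty => simp
  | insert a s ha ih => rw [Finset.sum_insert ha, Finset.prod_insert ha, expNeg_add, ih]

lemma continuous_expNeg : Continuous expNeg :=
  continuous_inv.comp (ENNReal.continuous_exp.comp continuous_coe_ennreal_ereal)

@[fun_prop] lemma measurable_expNeg : Measurable expNeg := continuous_expNeg.measurable

/-! ### The Laplace functional of a Poisson process -/

/-- The Laplace transform of the Poisson law, including the degenerate parameter `m = ∞`. -/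
lemma lintegral_expNeg_poissonLaw (m a : ℝ≥0∞) :
    ∫⁻ N, expNeg (a * N) ∂(poissonLaw m) = expNeg ((1 - expNeg a) * m) := by
  unfold poissonLaw
  split_ifs with hm
  · rw [lintegral_dirac, hm]
    rcases eq_or_ne a 0 with rfl | ha
    · simp
    · rw [ENNReal.mul_top ha, ENNReal.mul_top]
      refine (tsub_pos_of_lt ?_).ne'
      rcases eq_or_ne a ∞ with rfl | ha'
      · simp
      rw [expNeg_eq_ofReal ha']
      simpa using ENNReal.toReal_pos ha ha'
  · lift m to NNReal using hm
    rw [lintegral_map (by fun_prop) (by fun_prop), ENNReal.toNNReal_coe]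
    have h1 : ∀ k : ℕ, expNeg (a * k) = ENNReal.ofReal ((expNeg a).toReal ^ k) := by
      intro k
      rw [ENNReal.ofReal_pow ENNReal.toReal_nonneg, ENNReal.ofReal_toReal (expNeg_ne_top a)]
      induction k with
      | zero => simp
      | succ k ih => rw [Nat.cast_succ, mul_add, mul_one, expNeg_add, ih, pow_succ]
    set b := (expNeg a).toReal with hb
    have hb1 : b ≤ 1 := by
      have := ENNReal.toReal_mono ENNReal.one_ne_top (expNeg_le_one a)
      simpa using this
    have hb0 : 0 ≤ b := ENNReal.toReal_nonneg
    have h2 : (1 - expNeg a) * (m : ℝ≥0∞) = ENNReal.ofReal ((1 - b) * m) := by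
      rw [ENNReal.ofReal_mul (by linarith), ENNReal.ofReal_sub _ hb0, hb,
        ENNReal.ofReal_toReal (expNeg_ne_top a)]
      simp
    have h0 : 0 ≤ (1 - b) * m := mul_nonneg (by linarith) m.2
    rw [h2, expNeg_ofReal h0, lintegral_countable']
    simp_rw [h1, poissonMeasure_singleton]
    have h3 : ∀ k : ℕ, ENNReal.ofReal (b ^ k) * ENNReal.ofReal (Real.exp (-m) * m ^ k / k.factorial)
        = ENNReal.ofReal (Real.exp (-m) * ((b * m) ^ k / k.factorial)) := by
      intro k
      rw [← ENNReal.ofReal_mul (by positivity)]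
      congr 1
      ring
    simp_rw [h3]
    have h4 : HasSum (fun k : ℕ => Real.exp (-m) * ((b * m) ^ k / k.factorial))
        (Real.exp (-m) * Real.exp (b * m)) := by
      rw [Real.exp_eq_exp_ℝ]
      exact (NormedSpace.expSeries_div_hasSum_exp (b * (m : ℝ))).mul_left _
    rw [← ENNReal.ofReal_tsum_of_nonneg _ h4.summable, h4.tsum_eq, ← Real.exp_add]
    · congr 2; ring
    · intro k; positivity

/-- The sum of `f` over the points of the configuration. -/
def pointSum {Ω : Type*} (J : ℕ → Ω → ℝ) (f : ℝ → ℝ≥0∞) (ω : Ω) : ℝ≥0∞ := ∑' ℓ, f (J ℓ ω)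

lemma pointSum_add {Ω : Type*} (J : ℕ → Ω → ℝ) (f g : ℝ → ℝ≥0∞) (ω : Ω) :
    pointSum J (fun x => f x + g x) ω = pointSum J f ω + pointSum J g ω :=
  ENNReal.tsum_add

lemma pointSum_const_mul {Ω : Type*} (J : ℕ → Ω → ℝ) (a : ℝ≥0∞) (f : ℝ → ℝ≥0∞) (ω : Ω) :
    pointSum J (fun x => a * f x) ω = a * pointSum J f ω :=
  ENNReal.tsum_mul_left

/-- For a simple function the sum over the points is a combination of the counts on its level
sets. -/
lemma pointSum_simpleFunc {Ω : Type*} (J : ℕ → Ω → ℝ) (f : SimpleFunc ℝ ℝ≥0∞) (ω : Ω) :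
    pointSum J f ω = ∑ a ∈ f.range, a * pointCount J (f ⁻¹' {a}) ω := by
  unfold pointSum pointCount
  simp_rw [← ENNReal.tsum_mul_left]
  rw [← Summable.tsum_finsetSum (fun _ _ => ENNReal.summable)]
  refine tsum_congr fun ℓ => ?_
  rw [Finset.sum_eq_single (f (J ℓ ω))]
  · simp
  · intro b _ hb
    simp [hb.symm]
  · intro h
    exact absurd (f.mem_range_self _) h

section Laplace

variable {Ω : Type*} [MeasurableSpace Ω] {P : Measure Ω} {ν : Measure ℝ} {J : ℕ → Ω → ℝ}

lemma measurable_pointSum (hJ : ∀ ℓ, Measurable (J ℓ)) {f : ℝ → ℝ≥0∞} (hf : Measurable f) :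
    Measurable (pointSum J f) :=
  Measurable.tsum fun ℓ => hf.comp (hJ ℓ)

lemma IsPoissonEnumeration.lintegral_expNeg_simpleFunc (h : IsPoissonEnumeration ν J P)
    (f : SimpleFunc ℝ ℝ≥0∞) :
    ∫⁻ ω, expNeg (pointSum J f ω) ∂P = expNeg (∫⁻ x, (1 - expNeg (f x)) ∂ν) := by
  have hm : ∀ a, MeasurableSet (f ⁻¹' {a}) := fun a => f.measurableSet_fiber a
  have e := f.range.equivFin
  let A : Fin f.range.card → Set ℝ := fun i => f ⁻¹' {((e.symm i : f.range) : ℝ≥0∞)}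
  have hA : ∀ i, MeasurableSet (A i) := fun i => hm _
  have hind := h.indep_count _ A hA (by
    intro i j hij
    refine Disjoint.preimage _ (Set.disjoint_singleton.2 fun h => hij ?_)
    exact e.symm.injective (Subtype.ext h))
  have h1 : ∀ ω, expNeg (pointSum J f ω) =
      ∏ i, expNeg ((e.symm i : f.range) * pointCount J (A i) ω) := by
    intro ω
    rw [pointSum_simpleFunc, expNeg_sum, ← Finset.prod_coe_sort, ← e.symm.prod_comp]
  have hmeas : ∀ i, Measurable (pointCount J (A i)) := fun i =>
    measurable_pointSum h.measurable (measurable_const.indicator (hA i))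
  have h2 := hind.comp (fun i x => expNeg ((e.symm i : f.range) * x)) (fun i => by fun_prop)
  simp_rw [h1]
  have h3 := lintegral_prod_eq_prod_lintegral_of_indepFun Finset.univ _ h2
    (fun i => by have := hmeas i; fun_prop)
  simp only [Function.comp_apply] at h3
  rw [h3]
  have h4 : ∀ i, ∫⁻ ω, expNeg ((e.symm i : f.range) * pointCount J (A i) ω) ∂P =
      expNeg ((1 - expNeg (e.symm i : f.range)) * ν (A i)) := by
    intro i
    rw [← lintegral_expNeg_poissonLaw, ← (h.hasLaw_count (A i) (hA i)).map_eq,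
      lintegral_map (by fun_prop) (hmeas i)]
  simp_rw [h4]
  rw [← expNeg_sum]
  congr 1
  have h5 := (f.map fun a => 1 - expNeg a).lintegral_eq_lintegral ν
  rw [SimpleFunc.map_lintegral] at h5
  simp only [SimpleFunc.coe_map, Function.comp_apply] at h5
  rw [h5, ← Finset.sum_coe_sort f.range, ← e.symm.sum_comp]

/-- The Laplace functional of a Poisson process. For simple functions it is the independence of
the counts on the level sets; the general case follows by monotone approximation. -/
lemma IsPoissonEnumeration.lintegral_expNeg_pointSum [IsProbabilityMeasure P]
    (h : IsPoissonEnumeration ν J P) {f : ℝ → ℝ≥0∞} (hf : Measurable f) :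
    ∫⁻ ω, expNeg (pointSum J f ω) ∂P = expNeg (∫⁻ x, (1 - expNeg (f x)) ∂ν) := by
  have hmono := SimpleFunc.monotone_eapprox f
  have hsup : ∀ x, Tendsto (fun m => SimpleFunc.eapprox f m x) atTop (𝓝 (f x)) := by
    intro x
    rw [← SimpleFunc.iSup_eapprox_apply hf x]
    exact tendsto_atTop_iSup fun m m' hm => hmono hm x
  have hL : Tendsto (fun m => ∫⁻ ω, expNeg (pointSum J (SimpleFunc.eapprox f m) ω) ∂P) atTop
      (𝓝 (∫⁻ ω, expNeg (pointSum J f ω) ∂P)) := by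
    refine lintegral_tendsto_of_tendsto_of_antitone ?_ ?_ ?_ ?_
    · exact fun m => (measurable_expNeg.comp
        (measurable_pointSum h.measurable (SimpleFunc.measurable _))).aemeasurable
    · exact ae_of_all _ fun ω m m' hm => antitone_expNeg
        (ENNReal.tsum_le_tsum fun ℓ => hmono hm _)
    · refine ne_top_of_le_ne_top ENNReal.one_ne_top
        ((lintegral_mono fun ω => expNeg_le_one _).trans (by simp))
    · refine ae_of_all _ fun ω => (continuous_expNeg.tendsto _).comp ?_
      simp_rw [pointSum, ← lintegral_count]
      exact lintegral_tendsto_of_tendsto_of_monotone (fun m => (measurable_of_countable _).aemeasurable)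
        (ae_of_all _ fun ℓ m m' hm => hmono hm _) (ae_of_all _ fun ℓ => hsup _)
  have hR : Tendsto (fun m => ∫⁻ x, (1 - expNeg (SimpleFunc.eapprox f m x)) ∂ν) atTop
      (𝓝 (∫⁻ x, (1 - expNeg (f x)) ∂ν)) := by
    refine lintegral_tendsto_of_tendsto_of_monotone ?_ ?_ ?_
    · intro m
      have := (SimpleFunc.eapprox f m).measurable
      fun_prop
    · exact ae_of_all _ fun x m m' hm => tsub_le_tsub_left (antitone_expNeg (hmono hm x)) _
    · exact ae_of_all _ fun x => ENNReal.Tendsto.sub tendsto_const_nhds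
        ((continuous_expNeg.tendsto _).comp (hsup x)) (Or.inl ENNReal.one_ne_top)
  refine tendsto_nhds_unique hL ?_
  simp_rw [h.lintegral_expNeg_simpleFunc]
  exact (continuous_expNeg.tendsto _).comp hR

end Laplace

/-! ### Sums over tuples of distinct indices -/

/-- The distinct-index sum `∑ ∏ i, s (e i) ^ c i` over all tuples `e` of distinct indices. For a
mass function `s` it is the probability that the paintbox partition with weights `s` equals a given
partition with block sizes `c`. -/
def distinctSum {k : ℕ} (s : ℕ → ℝ≥0∞) (c : Fin k → ℕ) : ℝ≥0∞ :=
  ∑' e : Fin k → ℕ, if Function.Injective e then ∏ i, s (e i) ^ c i else 0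

@[fun_prop] lemma measurable_distinctSum {k : ℕ} (c : Fin k → ℕ) :
    Measurable fun s : ℕ → ℝ≥0∞ => distinctSum s c := by
  refine Measurable.tsum fun e => ?_
  split_ifs <;> fun_prop

lemma distinctSum_const_mul {k : ℕ} (a : ℝ≥0∞) (s : ℕ → ℝ≥0∞) (c : Fin k → ℕ) :
    distinctSum (fun ℓ => a * s ℓ) c = a ^ (∑ i, c i) * distinctSum s c := by
  unfold distinctSum
  rw [← ENNReal.tsum_mul_left]
  refine tsum_congr fun e => ?_
  split_ifs
  · simp_rw [mul_pow, Finset.prod_mul_distrib, Finset.prod_pow_eq_pow_sum]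
  · simp

lemma distinctSum_of_isEmpty (s : ℕ → ℝ≥0∞) (c : Fin 0 → ℕ) : distinctSum s c = 1 := by
  unfold distinctSum
  rw [tsum_eq_single (fun i => i.elim0) (fun e he => absurd (Subsingleton.elim _ _) he)]
  simp [Function.injective_of_subsingleton]

lemma insertNth_injective_iff {k : ℕ} {i : Fin (k + 1)} {ℓ : ℕ} {e : Fin k → ℕ} :
    Function.Injective (i.insertNth ℓ e : Fin (k + 1) → ℕ) ↔
      Function.Injective e ∧ ℓ ∉ Set.range e := by
  constructor
  · intro h
    refine ⟨fun a b hab => i.succAbove_right_injective (h (by simpa using hab)), ?_⟩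
    rintro ⟨j, hj⟩
    exact i.succAbove_ne j (h (by simpa using hj))
  · rintro ⟨he, hl⟩ a b hab
    have hl' : ∀ j, ℓ ≠ e j := fun j h => hl ⟨j, h.symm⟩
    rcases i.eq_self_or_eq_succAbove a with ha | ⟨a, rfl⟩ <;>
      rcases i.eq_self_or_eq_succAbove b with hb | ⟨b, rfl⟩
    · rw [ha, hb]
    · simp [ha, hl'] at hab
    · simp [hb, (hl' a).symm] at hab
    · simp only [Fin.insertNth_apply_succAbove] at hab
      rw [he hab]

lemma tsum_insertNth {k : ℕ} (i : Fin (k + 1)) (F : (Fin (k + 1) → ℕ) → ℝ≥0∞) :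
    ∑' x, F x = ∑' e : Fin k → ℕ, ∑' ℓ : ℕ, F (i.insertNth ℓ e) := by
  rw [← (Fin.insertNthEquiv (fun _ => ℕ) i).tsum_eq]
  refine (ENNReal.tsum_prod (f := fun ℓ e => F (i.insertNth ℓ e))).trans ENNReal.tsum_comm

/-- Summing over the `i`-th index separately. -/
lemma distinctSum_succ {k : ℕ} (s : ℕ → ℝ≥0∞) (c : Fin (k + 1) → ℕ) (i : Fin (k + 1)) :
    distinctSum s c = ∑' e : Fin k → ℕ, ∑' ℓ : ℕ,
      if Function.Injective e ∧ ℓ ∉ Set.range e then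
        s ℓ ^ c i * ∏ j, s (e j) ^ c (i.succAbove j) else 0 := by
  classical
  unfold distinctSum
  rw [tsum_insertNth i]
  refine tsum_congr fun e => tsum_congr fun ℓ => ?_
  simp only [insertNth_injective_iff, Fin.prod_univ_succAbove _ i, Fin.insertNth_apply_same,
    Fin.insertNth_apply_succAbove]

/-- Multiplying a distinct-index sum by a power sum: the new index is either distinct from the
previous ones or equal to exactly one of them. -/
lemma distinctSum_cons_add {k : ℕ} (s : ℕ → ℝ≥0∞) (m : ℕ) (c : Fin k → ℕ) :
    distinctSum s (Fin.cons m c : Fin (k + 1) → ℕ) +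
      ∑ i, distinctSum s (Function.update c i (c i + m)) = distinctSum s c * ∑' ℓ, s ℓ ^ m := by
  classical
  rw [distinctSum_succ s _ 0]
  unfold distinctSum
  rw [← Summable.tsum_finsetSum (fun _ _ => ENNReal.summable), ← ENNReal.tsum_add,
    ← ENNReal.tsum_mul_right]
  refine tsum_congr fun e => ?_
  by_cases he : Function.Injective e
  · simp only [he, true_and, if_true, Fin.cons_zero, Fin.succAbove_zero, Fin.cons_succ]
    have h1 : ∀ i, ∏ j, s (e j) ^ Function.update c i (c i + m) j =
        (∏ j, s (e j) ^ c j) * ∑' ℓ, if e i = ℓ then s ℓ ^ m else 0 := by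
      intro i
      rw [tsum_ite_eq' (e i) (fun ℓ => s ℓ ^ m), ← Finset.mul_prod_erase _ _ (Finset.mem_univ i),
        ← Finset.mul_prod_erase Finset.univ (fun j => s (e j) ^ c j) (Finset.mem_univ i)]
      rw [Finset.prod_congr rfl (g := fun j => s (e j) ^ c j)]
      · simp only [Function.update_self]
        ring
      · intro j hj
        rw [Function.update_of_ne (Finset.ne_of_mem_erase hj)]
    simp_rw [h1]
    rw [← Finset.mul_sum, ← Summable.tsum_finsetSum (fun _ _ => ENNReal.summable)]
    simp_rw [← ENNReal.tsum_mul_left]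
    rw [← ENNReal.tsum_add]
    refine tsum_congr fun ℓ => ?_
    by_cases hl : ℓ ∈ Set.range e
    · obtain ⟨i, rfl⟩ := hl
      simp [he.eq_iff]
    · have : ∀ i, e i ≠ ℓ := fun i h => hl ⟨i, h⟩
      simp [hl, this, mul_comm]
  · simp [he]

/-- Splitting a distinct-index sum according to which entry, if any, is the index `0`. -/
lemma distinctSum_stick {k : ℕ} (s s' : ℕ → ℝ≥0∞) (v : ℝ≥0∞) (hs : ∀ ℓ, s (ℓ + 1) = v * s' ℓ)
    (c : Fin (k + 1) → ℕ) :
    distinctSum s c = v ^ (∑ i, c i) * distinctSum s' c +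
      ∑ i, s 0 ^ c i * (v ^ (∑ j, c (i.succAbove j)) * distinctSum s' (fun j => c (i.succAbove j))) := by
  classical
  -- an injective tuple takes the value `0` at most once
  have hsplit : ∀ e : Fin (k + 1) → ℕ, (if Function.Injective e then ∏ i, s (e i) ^ c i else 0) =
      (if Function.Injective e ∧ ∀ i, e i ≠ 0 then ∏ i, s (e i) ^ c i else 0) +
      ∑ i, if Function.Injective e ∧ e i = 0 then ∏ i, s (e i) ^ c i else 0 := by
    intro e
    by_cases he : Function.Injective e
    · by_cases h0 : ∃ i, e i = 0
      · obtain ⟨i, hi⟩ := h0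
        have h1 : ∀ j, e j = 0 ↔ i = j := fun j => by rw [← hi, he.eq_iff, eq_comm]
        simp [he, h1]
      · push Not at h0
        simp [he, h0]
    · simp [he]
  -- tuples avoiding `0` are shifts of tuples indexing `s'`
  have hnz : ∀ {m : ℕ} (c : Fin m → ℕ),
      (∑' e : Fin m → ℕ, if Function.Injective e ∧ ∀ i, e i ≠ 0 then ∏ i, s (e i) ^ c i else 0) =
        v ^ (∑ i, c i) * distinctSum s' c := by
    intro m c
    rw [← distinctSum_const_mul]
    unfold distinctSum
    have hinj : Function.Injective (fun (e : Fin m → ℕ) i => e i + 1) := by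
      intro e e' h
      funext i
      simpa using congrFun h i
    rw [← hinj.tsum_eq]
    · refine tsum_congr fun e => ?_
      have : Function.Injective (fun i => e i + 1) ↔ Function.Injective e :=
        ⟨fun h => Function.Injective.of_comp (f := fun x => x + 1) h,
          fun h => (add_left_injective 1).comp h⟩
      simp [this, hs]
    · intro e he
      simp only [Function.mem_support, ne_eq, ite_eq_right_iff, Classical.not_imp] at he
      refine ⟨fun i => e i - 1, ?_⟩
      funext i
      have := he.1.2 i
      simp only
      omega
  unfold distinctSum
  simp_rw [hsplit]
  rw [ENNReal.tsum_add, hnz, Summable.tsum_finsetSum (fun _ _ => ENNReal.summable)]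
  congr 1
  refine Finset.sum_congr rfl fun i _ => ?_
  have := hnz (fun j => c (i.succAbove j))
  unfold distinctSum at this
  rw [← this, ← ENNReal.tsum_mul_left, tsum_insertNth i]
  refine tsum_congr fun e => ?_
  rw [tsum_eq_single 0]
  · have h : Function.Injective (i.insertNth 0 e : Fin (k + 1) → ℕ) ↔
        Function.Injective e ∧ ∀ j, e j ≠ 0 := by
      rw [insertNth_injective_iff, Set.mem_range, not_exists]
    simp only [h, Fin.prod_univ_succAbove _ i, Fin.insertNth_apply_same,
      Fin.insertNth_apply_succAbove, mul_ite, mul_zero, and_true]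
  · intro ℓ hℓ
    simp [hℓ]

lemma distinctSum_le_one {s : ℕ → ℝ≥0∞} (hs : ∑' ℓ, s ℓ ≤ 1) :
    ∀ {k : ℕ} (c : Fin k → ℕ), (∀ i, 1 ≤ c i) → distinctSum s c ≤ 1
  | 0, c, _ => (distinctSum_of_isEmpty s c).le
  | k + 1, c, hc => by
    have h1 := distinctSum_cons_add s (c 0) (Fin.tail c)
    rw [Fin.cons_self_tail] at h1
    refine (self_le_add_right _ _).trans (h1.le.trans ?_)
    refine mul_le_one' (distinctSum_le_one hs _ fun i => hc _) (le_trans ?_ hs)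
    refine ENNReal.tsum_le_tsum fun ℓ => ?_
    exact pow_le_of_le_one (zero_le) ((ENNReal.le_tsum ℓ).trans hs) (by have := hc 0; omega)

/-! ### Differentiating Laplace transforms -/

/-- The difference quotient of `h ↦ -e^{-hx}` at `0` tends to `x`, also when `x = ∞`. -/
lemma tendsto_one_sub_expNeg_div (x : ℝ≥0∞) :
    Tendsto (fun h : ℝ => (1 - expNeg (ENNReal.ofReal h * x)) / ENNReal.ofReal h) (𝓝[>] 0) (𝓝 x) := by
  rcases eq_or_ne x ∞ with rfl | hx
  · have h1 : Tendsto (fun h : ℝ => (ENNReal.ofReal h)⁻¹) (𝓝[>] 0) (𝓝 ∞) := by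
      rw [← ENNReal.inv_zero]
      refine (continuous_inv.tendsto 0).comp ?_
      simpa using (ENNReal.continuous_ofReal.tendsto 0).mono_left nhdsWithin_le_nhds
    refine h1.congr' ?_
    filter_upwards [self_mem_nhdsWithin] with h hh
    rw [ENNReal.mul_top (by simpa using hh)]
    simp
  · lift x to NNReal using hx
    have h1 : HasDerivAt (fun h : ℝ => - Real.exp (-(h * x))) (x : ℝ) 0 := by
      have := ((((hasDerivAt_id (0 : ℝ)).mul_const (x : ℝ)).neg).exp).neg
      simpa [Pi.neg_def] using this
    have h2 := (ENNReal.continuous_ofReal.tendsto _).comp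
      ((hasDerivAt_iff_tendsto_slope.1 h1).mono_left
        (nhdsWithin_mono 0 (fun h (hh : 0 < h) => hh.ne')))
    rw [ENNReal.ofReal_coe_nnreal] at h2
    refine h2.congr' ?_
    filter_upwards [self_mem_nhdsWithin] with h (hh : 0 < h)
    have h3 : ENNReal.ofReal h * x = ENNReal.ofReal (h * x) := by
      rw [ENNReal.ofReal_mul hh.le, ENNReal.ofReal_coe_nnreal]
    rw [h3, expNeg_ofReal (by positivity), ← ENNReal.ofReal_one,
      ← ENNReal.ofReal_sub _ (Real.exp_pos _).le, ← ENNReal.ofReal_div_of_pos hh]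
    simp only [Function.comp_apply, slope_def_field]
    congr 1
    simp only [zero_mul, neg_zero, Real.exp_zero, sub_zero]
    ring

lemma one_sub_expNeg_le (x : ℝ≥0∞) : 1 - expNeg x ≤ x := by
  rcases eq_or_ne x ∞ with rfl | hx
  · simp
  rw [expNeg_eq_ofReal hx, ← ENNReal.ofReal_one, ← ENNReal.ofReal_sub _ (Real.exp_pos _).le]
  refine ENNReal.ofReal_le_of_le_toReal ?_
  have := Real.add_one_le_exp (-x.toReal)
  linarith

/-- The difference quotient of `h ↦ e^{-hx}` at `0` shrinks when the step is doubled. -/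
lemma one_sub_expNeg_two_mul_le (x : ℝ≥0∞) : 1 - expNeg (2 * x) ≤ 2 * (1 - expNeg x) := by
  have h1 : 1 - expNeg x + expNeg x = 1 := tsub_add_cancel_of_le (expNeg_le_one x)
  rw [tsub_le_iff_right, two_mul x, expNeg_add]
  set q := expNeg x
  have hq : 1 - q ≠ ∞ := by simp
  calc (1 : ℝ≥0∞) = (1 - q + q) * (1 - q + q) := by rw [h1, one_mul]
    _ = (1 - q) * (1 - q + q) + q * (1 - q) + q * q := by ring
    _ ≤ (1 - q) * (1 - q + q) + 1 * (1 - q) + q * q := by gcongr; exact expNeg_le_one x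
    _ = 2 * (1 - q) + q * q := by rw [h1]; ring

section Slope

variable {α : Type*} [MeasurableSpace α] {μ : Measure α} {w g : α → ℝ≥0∞}

/-- The derivative at `0` of a Laplace transform, along the sequence `2⁻ⁿ` for which the
difference quotients increase. By monotone convergence the derivative need not be known to be
finite. -/
lemma tendsto_two_pow_mul_lintegral (hw : Measurable w) (hg : Measurable g)
    (hwi : ∫⁻ a, w a ∂μ ≠ ∞) :
    Tendsto (fun n : ℕ => 2 ^ n *
      ∫⁻ a, w a * (1 - expNeg (ENNReal.ofReal ((1 / 2) ^ n) * g a)) ∂μ) atTop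
      (𝓝 (∫⁻ a, w a * g a ∂μ)) := by
  have h2 : ∀ n : ℕ, ENNReal.ofReal ((1 / 2) ^ n) = (2 ^ n : ℝ≥0∞)⁻¹ := by
    intro n
    rw [one_div, inv_pow, ENNReal.ofReal_inv_of_pos (by positivity),
      ENNReal.ofReal_pow (by norm_num)]
    simp
  have hm : ∀ n : ℕ, Measurable fun a =>
      w a * (1 - expNeg (ENNReal.ofReal ((1 / 2) ^ n) * g a)) := fun n => by fun_prop
  simp_rw [fun n => (lintegral_const_mul (μ := μ) (2 ^ n) (hm n)).symm]
  refine lintegral_tendsto_of_tendsto_of_monotone (fun n => by fun_prop) ?_ ?_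
  · refine ae_of_all _ fun a => monotone_nat_of_le_succ fun n => ?_
    have h3 : ENNReal.ofReal ((1 / 2) ^ n) * g a =
        2 * (ENNReal.ofReal ((1 / 2) ^ (n + 1)) * g a) := by
      rw [h2, h2, pow_succ, ENNReal.mul_inv (by simp) (by simp), mul_comm _ (2 : ℝ≥0∞)⁻¹,
        ← mul_assoc, ← mul_assoc, ENNReal.mul_inv_cancel (by simp) (by simp), one_mul]
    rw [h3]
    calc 2 ^ n * (w a * (1 - expNeg (2 * (ENNReal.ofReal ((1 / 2) ^ (n + 1)) * g a))))
        ≤ 2 ^ n * (w a * (2 * (1 - expNeg (ENNReal.ofReal ((1 / 2) ^ (n + 1)) * g a)))) := by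
          gcongr; exact one_sub_expNeg_two_mul_le _
      _ = _ := by ring
  · filter_upwards [ae_lt_top hw hwi] with a hwa
    have h3 : Tendsto (fun n : ℕ => (1 / 2 : ℝ) ^ n) atTop (𝓝[>] 0) :=
      tendsto_nhdsWithin_iff.2 ⟨tendsto_pow_atTop_nhds_zero_of_lt_one (by norm_num) (by norm_num),
        Eventually.of_forall fun n => by simp⟩
    have h4 := (tendsto_one_sub_expNeg_div (g a)).comp h3
    have h5 := ENNReal.Tendsto.const_mul (a := w a) h4 (Or.inr hwa.ne)
    refine h5.congr fun n => ?_
    simp only [Function.comp_apply, h2, ENNReal.div_eq_inv_mul, inv_inv]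
    ring

/-- The right derivative at `0` of a Laplace transform with integrable derivative. -/
lemma hasDerivWithinAt_lintegral_one_sub_expNeg (hw : Measurable w) (hg : Measurable g)
    (hwg : ∫⁻ a, w a * g a ∂μ ≠ ∞) :
    HasDerivWithinAt (fun h : ℝ => (∫⁻ a, w a * (1 - expNeg (ENNReal.ofReal h * g a)) ∂μ).toReal)
      (∫⁻ a, w a * g a ∂μ).toReal (Set.Ici 0) 0 := by
  have hae : ∀ᵐ a ∂μ, w a * g a < ∞ := ae_lt_top (hw.mul hg) hwg
  rw [hasDerivWithinAt_iff_tendsto_slope, Set.Ici_sdiff_left]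
  have h1 : Tendsto (fun h : ℝ => ∫⁻ a, w a * ((1 - expNeg (ENNReal.ofReal h * g a)) /
      ENNReal.ofReal h) ∂μ) (𝓝[>] 0) (𝓝 (∫⁻ a, w a * g a ∂μ)) := by
    refine tendsto_lintegral_filter_of_dominated_convergence (fun a => w a * g a) ?_ ?_ hwg ?_
    · exact Eventually.of_forall fun h => by fun_prop
    · filter_upwards [self_mem_nhdsWithin] with h (hh : 0 < h)
      refine ae_of_all _ fun a => ?_
      gcongr
      refine ENNReal.div_le_of_le_mul ?_
      rw [mul_comm]
      exact one_sub_expNeg_le _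
    · filter_upwards [hae] with a ha
      rcases eq_or_ne (w a) ∞ with hwa | hwa
      · have : g a = 0 := by
          by_contra hga
          rw [hwa, ENNReal.top_mul hga] at ha
          exact lt_irrefl _ ha
        simp [this]
      · exact ENNReal.Tendsto.const_mul (tendsto_one_sub_expNeg_div (g a)) (Or.inr hwa)
  refine ((ENNReal.tendsto_toReal hwg).comp h1).congr' ?_
  filter_upwards [self_mem_nhdsWithin] with h (hh : 0 < h)
  have h2 : ∀ a, w a * ((1 - expNeg (ENNReal.ofReal h * g a)) / ENNReal.ofReal h) =
      (ENNReal.ofReal h)⁻¹ * (w a * (1 - expNeg (ENNReal.ofReal h * g a))) := by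
    intro a; rw [ENNReal.div_eq_inv_mul]; ring
  simp only [Function.comp_apply, h2]
  rw [lintegral_const_mul _ (by fun_prop), ENNReal.toReal_mul, ENNReal.toReal_inv,
    ENNReal.toReal_ofReal hh.le, slope_def_field]
  simp [div_eq_inv_mul]

end Slope

/-! ### The multivariate Mecke formula for powers -/

/-- The tilted moment `∫ (x⁺)^c e^{-f(x)} ν(dx)`. -/
def tiltedMoment (ν : Measure ℝ) (f : ℝ → ℝ≥0∞) (c : ℕ) : ℝ≥0∞ :=
  ∫⁻ x, expNeg (f x) * ENNReal.ofReal x ^ c ∂ν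

/-- The Laplace exponent `∫ (1 - e^{-f(x)}) ν(dx)`. -/
def laplaceExponent (ν : Measure ℝ) (f : ℝ → ℝ≥0∞) : ℝ≥0∞ := ∫⁻ x, (1 - expNeg (f x)) ∂ν

lemma tiltedMoment_mono {ν : Measure ℝ} {f f' : ℝ → ℝ≥0∞} (h : ∀ x, f x ≤ f' x) (c : ℕ) :
    tiltedMoment ν f' c ≤ tiltedMoment ν f c :=
  lintegral_mono fun x => by gcongr; exact antitone_expNeg (h x)

lemma one_sub_expNeg_add (x y : ℝ≥0∞) :
    1 - expNeg (x + y) = (1 - expNeg x) + expNeg x * (1 - expNeg y) := by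
  rw [expNeg_add, ENNReal.mul_sub (fun _ _ => expNeg_ne_top x), mul_one]
  refine ENNReal.sub_eq_of_eq_add
    (ENNReal.mul_ne_top (expNeg_ne_top _) (expNeg_ne_top _)) ?_
  rw [add_assoc, tsub_add_cancel_of_le (mul_le_of_le_one_right' (expNeg_le_one y)),
    tsub_add_cancel_of_le (expNeg_le_one x)]

lemma laplaceExponent_add {ν : Measure ℝ} {f g : ℝ → ℝ≥0∞} (hf : Measurable f) :
    laplaceExponent ν (fun x => f x + g x) =
      laplaceExponent ν f + ∫⁻ x, expNeg (f x) * (1 - expNeg (g x)) ∂ν := by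
  unfold laplaceExponent
  rw [← lintegral_add_left (by fun_prop)]
  simp_rw [one_sub_expNeg_add]

lemma laplaceExponent_add_le {ν : Measure ℝ} {f : ℝ → ℝ≥0∞} (hf : Measurable f) (a : ℝ≥0∞) (m : ℕ) :
    laplaceExponent ν (fun x => f x + a * ENNReal.ofReal x ^ m) ≤
      laplaceExponent ν f + a * tiltedMoment ν f m := by
  rw [laplaceExponent_add hf, tiltedMoment, ← lintegral_const_mul _ (by fun_prop)]
  refine add_le_add le_rfl (lintegral_mono fun x => ?_)
  calc expNeg (f x) * (1 - expNeg (a * ENNReal.ofReal x ^ m))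
      ≤ expNeg (f x) * (a * ENNReal.ofReal x ^ m) := by gcongr; exact one_sub_expNeg_le _
    _ = _ := by ring

/-- A perturbed tilted moment as the unperturbed one minus a Laplace-type integral. -/
lemma tiltedMoment_add_eq {ν : Measure ℝ} {f : ℝ → ℝ≥0∞} (hf : Measurable f) (a : ℝ≥0∞) (m c : ℕ)
    (hc : tiltedMoment ν f c ≠ ∞) :
    (tiltedMoment ν (fun x => f x + a * ENNReal.ofReal x ^ m) c).toReal =
      (tiltedMoment ν f c).toReal - (∫⁻ x, expNeg (f x) * ENNReal.ofReal x ^ c *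
        (1 - expNeg (a * ENNReal.ofReal x ^ m)) ∂ν).toReal := by
  have h : tiltedMoment ν f c = tiltedMoment ν (fun x => f x + a * ENNReal.ofReal x ^ m) c +
      ∫⁻ x, expNeg (f x) * ENNReal.ofReal x ^ c * (1 - expNeg (a * ENNReal.ofReal x ^ m)) ∂ν := by
    unfold tiltedMoment
    rw [← lintegral_add_left (by fun_prop)]
    refine lintegral_congr fun x => ?_
    rw [expNeg_add]
    calc _ = expNeg (f x) * ENNReal.ofReal x ^ c * (expNeg (a * ENNReal.ofReal x ^ m) +
        (1 - expNeg (a * ENNReal.ofReal x ^ m))) := by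
          rw [add_tsub_cancel_of_le (expNeg_le_one _), mul_one]
      _ = _ := by ring
  rw [h] at hc ⊢
  rw [ENNReal.toReal_add (by exact fun h' => hc (by simp [h'])) (by exact fun h' => hc (by simp [h']))]
  ring

section Mecke

variable {Ω : Type*} [MeasurableSpace Ω] {P : Measure Ω} {ν : Measure ℝ} {J : ℕ → Ω → ℝ}

/-- With `M_c(f) = ∫ x^c e^{-f} dν` and `ψ(f) = ∫ (1 - e^{-f}) dν`, the right derivative at
`h = 0` of `h ↦ (∏ i, M_{c i}(f + h x^m)) e^{-ψ(f + h x^m)}`. -/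
lemma hasDerivWithinAt_prod_tiltedMoment {f : ℝ → ℝ≥0∞} (hf : Measurable f)
    (hM : ∀ m, 1 ≤ m → tiltedMoment ν f m ≠ ∞) (hψ : laplaceExponent ν f ≠ ∞)
    {k : ℕ} (c : Fin k → ℕ) (hc : ∀ i, 1 ≤ c i) {m : ℕ} (hm : 1 ≤ m) :
    HasDerivWithinAt (fun h : ℝ =>
      (∏ i, (tiltedMoment ν (fun x => f x + ENNReal.ofReal h * ENNReal.ofReal x ^ m) (c i)).toReal) *
        Real.exp (-(laplaceExponent ν
          (fun x => f x + ENNReal.ofReal h * ENNReal.ofReal x ^ m)).toReal))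
      (-((∑ i, ∏ j, (tiltedMoment ν f (Function.update c i (c i + m) j)).toReal) +
        (∏ i, (tiltedMoment ν f (c i)).toReal) * (tiltedMoment ν f m).toReal) *
          Real.exp (-(laplaceExponent ν f).toReal)) (Set.Ici 0) 0 := by
  classical
  have h1 : ∀ i, HasDerivWithinAt (fun h : ℝ => (tiltedMoment ν
      (fun x => f x + ENNReal.ofReal h * ENNReal.ofReal x ^ m) (c i)).toReal)
      (-(tiltedMoment ν f (c i + m)).toReal) (Set.Ici 0) 0 := by
    intro i
    have e : ∫⁻ x, expNeg (f x) * ENNReal.ofReal x ^ c i * ENNReal.ofReal x ^ m ∂ν =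
        tiltedMoment ν f (c i + m) := by
      unfold tiltedMoment
      refine lintegral_congr fun x => ?_
      rw [mul_assoc, ← pow_add]
    have := hasDerivWithinAt_lintegral_one_sub_expNeg (μ := ν)
      (w := fun x => expNeg (f x) * ENNReal.ofReal x ^ c i) (g := fun x => ENNReal.ofReal x ^ m)
      (by fun_prop) (by fun_prop) (by rw [e]; exact hM _ (by omega))
    rw [e] at this
    simp_rw [fun h => tiltedMoment_add_eq hf (ENNReal.ofReal h) m (c i) (hM _ (hc i))]
    exact this.const_sub _
  have h2 : HasDerivWithinAt (fun h : ℝ => (laplaceExponent ν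
      (fun x => f x + ENNReal.ofReal h * ENNReal.ofReal x ^ m)).toReal)
      (tiltedMoment ν f m).toReal (Set.Ici 0) 0 := by
    have := hasDerivWithinAt_lintegral_one_sub_expNeg (μ := ν)
      (w := fun x => expNeg (f x)) (g := fun x => ENNReal.ofReal x ^ m)
      (by fun_prop) (by fun_prop) (hM m hm)
    refine (this.const_add (laplaceExponent ν f).toReal).congr_of_mem (fun h hh => ?_) (by simp)
    rw [laplaceExponent_add hf, ENNReal.toReal_add hψ]
    have h3 := laplaceExponent_add_le (ν := ν) hf (ENNReal.ofReal h) m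
    rw [laplaceExponent_add hf] at h3
    exact ne_top_of_le_ne_top (ENNReal.add_ne_top.2 ⟨hψ, ENNReal.mul_ne_top (by simp) (hM m hm)⟩)
      (le_add_self.trans h3)
  have h3 := (HasDerivWithinAt.fun_finsetProd (u := Finset.univ) fun i _ => h1 i).mul h2.fun_neg.exp
  refine h3.congr_deriv ?_
  have h4 : ∀ i, ∏ j, (tiltedMoment ν f (Function.update c i (c i + m) j)).toReal =
      (∏ j ∈ Finset.univ.erase i, (tiltedMoment ν f (c j)).toReal) *
        (tiltedMoment ν f (c i + m)).toReal := by
    intro i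
    rw [← Finset.mul_prod_erase _ _ (Finset.mem_univ i), Function.update_self, mul_comm]
    congr 1
    refine Finset.prod_congr rfl fun j hj => ?_
    rw [Function.update_of_ne (Finset.ne_of_mem_erase hj)]
  simp only [h4, ENNReal.ofReal_zero, zero_mul, add_zero, smul_eq_mul, mul_neg,
    Finset.sum_neg_distrib]
  ring

/-- **Multivariate Mecke formula** for the power functions `x ↦ x^c`, in the form of a joint
Laplace transform. By induction on the number of indices: perturbing `f` by `h x^m` and
differentiating at `h = 0` brings down the power sum `∑ x^m` over the points, whose product with a
distinct-index sum is expanded by `distinctSum_cons_add`. -/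
theorem IsPoissonEnumeration.lintegral_distinctSum_mul_expNeg [IsProbabilityMeasure P]
    (h : IsPoissonEnumeration ν J P) {k : ℕ} (c : Fin k → ℕ) (hc : ∀ i, 1 ≤ c i)
    {f : ℝ → ℝ≥0∞} (hf : Measurable f) (hM : ∀ m, 1 ≤ m → tiltedMoment ν f m ≠ ∞)
    (hψ : laplaceExponent ν f ≠ ∞) :
    ∫⁻ ω, distinctSum (fun ℓ => ENNReal.ofReal (J ℓ ω)) c * expNeg (pointSum J f ω) ∂P =
      (∏ i, tiltedMoment ν f (c i)) * expNeg (laplaceExponent ν f) := by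
  classical
  induction k generalizing f with
  | zero =>
    simp only [distinctSum_of_isEmpty, one_mul, Finset.univ_eq_empty, Finset.prod_empty]
    exact h.lintegral_expNeg_pointSum hf
  | succ k ih =>
    obtain ⟨m, c, rfl⟩ : ∃ m c', c = Fin.cons m c' := ⟨c 0, Fin.tail c, (Fin.cons_self_tail c).symm⟩
    have hm : 1 ≤ m := hc 0
    replace hc : ∀ i, 1 ≤ c i := fun i => hc i.succ
    have hup : ∀ i j, 1 ≤ Function.update c i (c i + m) j := by
      intro i j
      by_cases hj : j = i
      · subst hj; simp; omega
      · simp [Function.update_of_ne hj, hc j]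
    have hmJ := h.measurable
    have hmD : ∀ {k : ℕ} (c : Fin k → ℕ),
        Measurable fun ω => distinctSum (fun ℓ => ENNReal.ofReal (J ℓ ω)) c := by
      intro k c
      exact (measurable_distinctSum c).comp (measurable_pi_lambda _ fun ℓ => (hmJ ℓ).ennreal_ofReal)
    have hmS := measurable_expNeg.comp (measurable_pointSum hmJ hf)
    have hmDS : ∀ {k : ℕ} (c : Fin k → ℕ), Measurable fun ω =>
        distinctSum (fun ℓ => ENNReal.ofReal (J ℓ ω)) c * expNeg (pointSum J f ω) :=
      fun c => (hmD c).mul hmS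
    have hmm : Measurable fun x : ℝ => ENNReal.ofReal x ^ m := by fun_prop
    have hmX := measurable_pointSum hmJ hmm
    set w : Ω → ℝ≥0∞ := fun ω =>
      distinctSum (fun ℓ => ENNReal.ofReal (J ℓ ω)) c * expNeg (pointSum J f ω) with hw
    have hmw : Measurable w := hmDS c
    set R : ℝ → ℝ := fun h : ℝ =>
      (∏ i, (tiltedMoment ν (fun x => f x + ENNReal.ofReal h * ENNReal.ofReal x ^ m) (c i)).toReal) *
        Real.exp (-(laplaceExponent ν
          (fun x => f x + ENNReal.ofReal h * ENNReal.ofReal x ^ m)).toReal) with hR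
    -- the values of the transform along the ray `f + a x^m`
    have hval : ∀ a : ℝ, ∫⁻ ω, w ω * expNeg (ENNReal.ofReal a *
        pointSum J (fun x => ENNReal.ofReal x ^ m) ω) ∂P = ENNReal.ofReal (R a) := by
      intro a
      have hle : ∀ x, f x ≤ f x + ENNReal.ofReal a * ENNReal.ofReal x ^ m := fun x => le_self_add
      have hM' : ∀ j, 1 ≤ j → tiltedMoment ν
          (fun x => f x + ENNReal.ofReal a * ENNReal.ofReal x ^ m) j ≠ ∞ := fun j hj =>
        ne_top_of_le_ne_top (hM j hj) (tiltedMoment_mono hle j)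
      have hψ' : laplaceExponent ν (fun x => f x + ENNReal.ofReal a * ENNReal.ofReal x ^ m) ≠ ∞ :=
        ne_top_of_le_ne_top (ENNReal.add_ne_top.2 ⟨hψ, ENNReal.mul_ne_top (by simp) (hM m hm)⟩)
          (laplaceExponent_add_le hf _ m)
      have := ih c hc (f := fun x => f x + ENNReal.ofReal a * ENNReal.ofReal x ^ m)
        (by fun_prop) hM' hψ'
      simp only [hw, hR]
      rw [ENNReal.ofReal_mul (Finset.prod_nonneg fun _ _ => ENNReal.toReal_nonneg),
        ENNReal.ofReal_prod_of_nonneg fun _ _ => ENNReal.toReal_nonneg, ← expNeg_eq_ofReal hψ']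
      simp_rw [fun i => ENNReal.ofReal_toReal (hM' (c i) (hc i))]
      rw [← this]
      refine lintegral_congr fun ω => ?_
      rw [pointSum_add, pointSum_const_mul, expNeg_add, mul_assoc]
    have hw0 : ∫⁻ ω, w ω ∂P = ENNReal.ofReal (R 0) := by
      rw [← hval 0]; simp
    have hd := hasDerivWithinAt_prod_tiltedMoment hf hM hψ c hc hm
    set R' : ℝ := (∑ i, ∏ j, (tiltedMoment ν f (Function.update c i (c i + m) j)).toReal) +
        (∏ i, (tiltedMoment ν f (c i)).toReal) * (tiltedMoment ν f m).toReal with hR'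
    have hlim := tendsto_two_pow_mul_lintegral (μ := P) hmw hmX (by rw [hw0]; simp)
    have hdiff : ∀ n : ℕ, 2 ^ n * ∫⁻ ω, w ω * (1 - expNeg (ENNReal.ofReal ((1 / 2) ^ n) *
        pointSum J (fun x => ENNReal.ofReal x ^ m) ω)) ∂P =
        ENNReal.ofReal (-slope R 0 ((1 / 2) ^ n)) := by
      intro n
      have h1 : ∀ ω, w ω * (1 - expNeg (ENNReal.ofReal ((1 / 2) ^ n) *
          pointSum J (fun x => ENNReal.ofReal x ^ m) ω)) + w ω * expNeg (ENNReal.ofReal ((1 / 2) ^ n) *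
          pointSum J (fun x => ENNReal.ofReal x ^ m) ω) = w ω := by
        intro ω
        rw [← mul_add, tsub_add_cancel_of_le (expNeg_le_one _), mul_one]
      have h2 := lintegral_congr (μ := P) h1
      rw [lintegral_add_right _ (by fun_prop), hval, hw0] at h2
      have h3 := ENNReal.eq_sub_of_add_eq (by simp) h2
      have hR0 : 0 ≤ R ((1 / 2) ^ n) := by simp only [hR]; positivity
      rw [h3, ← ENNReal.ofReal_sub _ hR0, slope_def_field]
      have h4 : (2 : ℝ≥0∞) ^ n = ENNReal.ofReal (2 ^ n) := by
        rw [ENNReal.ofReal_pow (by norm_num)]; simp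
      rw [h4, ← ENNReal.ofReal_mul (by positivity)]
      congr 1
      rw [sub_zero, div_pow, one_pow]
      field_simp
      ring
    simp_rw [hdiff] at hlim
    have hpow : Tendsto (fun n : ℕ => (1 / 2 : ℝ) ^ n) atTop (𝓝[Set.Ici 0 \ {0}] 0) := by
      rw [Set.Ici_sdiff_left]
      exact tendsto_nhdsWithin_iff.2
        ⟨tendsto_pow_atTop_nhds_zero_of_lt_one (by norm_num) (by norm_num),
          Eventually.of_forall fun n => by simp⟩
    have hlim2 := (ENNReal.continuous_ofReal.tendsto _).comp
      (((hasDerivWithinAt_iff_tendsto_slope.1 hd).comp hpow).neg)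
    have hEX := tendsto_nhds_unique hlim hlim2
    -- split the product of the distinct-index sum with the power sum
    have hsplit : ∫⁻ ω, w ω * pointSum J (fun x => ENNReal.ofReal x ^ m) ω ∂P =
        ∫⁻ ω, distinctSum (fun ℓ => ENNReal.ofReal (J ℓ ω)) (Fin.cons m c : Fin (k + 1) → ℕ) *
          expNeg (pointSum J f ω) ∂P +
        ∑ i, (∏ j, tiltedMoment ν f (Function.update c i (c i + m) j)) *
          expNeg (laplaceExponent ν f) := by
      have : ∀ i, (∏ j, tiltedMoment ν f (Function.update c i (c i + m) j)) *
          expNeg (laplaceExponent ν f) = ∫⁻ ω, distinctSum (fun ℓ => ENNReal.ofReal (J ℓ ω))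
            (Function.update c i (c i + m)) * expNeg (pointSum J f ω) ∂P := by
        intro i
        exact (ih _ (hup i) hf hM hψ).symm
      simp_rw [this]
      rw [← lintegral_finsetSum _ (fun i _ => hmDS _), ← lintegral_add_left (hmDS _)]
      refine lintegral_congr fun ω => ?_
      have := distinctSum_cons_add (fun ℓ => ENNReal.ofReal (J ℓ ω)) m c
      rw [← Finset.sum_mul, ← add_mul, this, hw, pointSum]
      ring
    rw [hsplit] at hEX
    -- the derivative contains the same correction terms, which therefore cancel
    have hMt : ∀ j, 1 ≤ j → ENNReal.ofReal (tiltedMoment ν f j).toReal = tiltedMoment ν f j :=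
      fun j hj => ENNReal.ofReal_toReal (hM j hj)
    have hfin : ENNReal.ofReal (-(-R' * Real.exp (-(laplaceExponent ν f).toReal))) =
        (∏ i, tiltedMoment ν f ((Fin.cons m c : Fin (k + 1) → ℕ) i)) * expNeg (laplaceExponent ν f) +
        ∑ i, (∏ j, tiltedMoment ν f (Function.update c i (c i + m) j)) *
          expNeg (laplaceExponent ν f) := by
      have hp : ∀ {k : ℕ} (c : Fin k → ℕ), 0 ≤ ∏ i, (tiltedMoment ν f (c i)).toReal := fun c =>
        Finset.prod_nonneg fun _ _ => ENNReal.toReal_nonneg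
      have hp' : ∀ {k : ℕ} (c : Fin k → ℕ), (∀ i, 1 ≤ c i) →
          ENNReal.ofReal (∏ i, (tiltedMoment ν f (c i)).toReal) = ∏ i, tiltedMoment ν f (c i) := by
        intro k c hc
        rw [ENNReal.ofReal_prod_of_nonneg fun _ _ => ENNReal.toReal_nonneg]
        exact Finset.prod_congr rfl fun i _ => hMt _ (hc i)
      have hs : 0 ≤ ∑ i, ∏ j, (tiltedMoment ν f (Function.update c i (c i + m) j)).toReal :=
        Finset.sum_nonneg fun i _ => hp _
      rw [neg_mul, neg_neg, ENNReal.ofReal_mul (by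
          exact add_nonneg hs (mul_nonneg (hp c) ENNReal.toReal_nonneg)), hR',
        ENNReal.ofReal_add hs (mul_nonneg (hp c) ENNReal.toReal_nonneg),
        ENNReal.ofReal_mul (hp c), hMt m hm, hp' c hc, ENNReal.ofReal_sum_of_nonneg fun i _ => hp _,
        ← expNeg_eq_ofReal hψ, ← Finset.sum_mul, Fin.prod_univ_succ]
      simp_rw [fun i => hp' _ (hup i)]
      simp only [Fin.cons_zero, Fin.cons_succ]
      ring
    rw [hfin] at hEX
    refine (ENNReal.add_left_inj ?_).1 hEX
    refine ENNReal.sum_ne_top.2 fun i _ => ENNReal.mul_ne_top ?_ (expNeg_ne_top _)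
    exact ENNReal.prod_ne_top fun j _ => hM _ (hup i j)

end Mecke

/-! ### Gamma and beta integrals -/

lemma lintegral_rpow_mul_exp_neg {a r : ℝ} (ha : 0 < a) (hr : 0 < r) :
    ∫⁻ x in Set.Ioi (0 : ℝ), ENNReal.ofReal (x ^ (a - 1) * Real.exp (-(r * x))) =
      ENNReal.ofReal (Real.Gamma a * r ^ (-a)) := by
  have h := Real.integral_rpow_mul_exp_neg_mul_Ioi ha hr
  have hG := Real.Gamma_pos_of_pos ha
  rw [← ofReal_integral_eq_lintegral_ofReal, h, one_div, Real.inv_rpow hr.le, Real.rpow_neg hr.le,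
    mul_comm]
  · exact .of_integral_ne_zero (by rw [h]; positivity)
  · filter_upwards [ae_restrict_mem measurableSet_Ioi] with x (hx : 0 < x)
    positivity

/-- The beta integral of the second kind: write `(1 + s)^{-(a + b)}` as a Gamma integral and
exchange the integrals. -/
lemma lintegral_rpow_mul_one_add_rpow {a b : ℝ} (ha : 0 < a) (hb : 0 < b) :
    ∫⁻ s in Set.Ioi (0 : ℝ), ENNReal.ofReal (s ^ (a - 1) * (1 + s) ^ (-(a + b))) =
      ENNReal.ofReal (Real.Gamma a * Real.Gamma b / Real.Gamma (a + b)) := by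
  have hab : 0 < a + b := by positivity
  have hG := Real.Gamma_pos_of_pos hab
  have hGa := Real.Gamma_pos_of_pos ha
  have hGb := Real.Gamma_pos_of_pos hb
  have h1 : ∀ s ∈ Set.Ioi (0 : ℝ), ENNReal.ofReal (s ^ (a - 1) * (1 + s) ^ (-(a + b))) =
      ∫⁻ y in Set.Ioi (0 : ℝ), ENNReal.ofReal (1 / Real.Gamma (a + b)) *
        (ENNReal.ofReal (y ^ (a + b - 1) * Real.exp (-y)) *
        ENNReal.ofReal (s ^ (a - 1) * Real.exp (-(y * s)))) := by
    intro s (hs : 0 < s)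
    have : s ^ (a - 1) * (1 + s) ^ (-(a + b)) = s ^ (a - 1) / Real.Gamma (a + b) *
        (Real.Gamma (a + b) * (1 + s) ^ (-(a + b))) := by field_simp
    rw [this, ENNReal.ofReal_mul (by positivity), ← lintegral_rpow_mul_exp_neg hab (by positivity),
      ← lintegral_const_mul _ (by fun_prop)]
    refine setLIntegral_congr_fun measurableSet_Ioi fun y (hy : 0 < y) => ?_
    rw [← ENNReal.ofReal_mul (by positivity), ← ENNReal.ofReal_mul (by positivity),
      ← ENNReal.ofReal_mul (by positivity)]
    congr 1
    rw [show -((1 + s) * y) = -y + -(y * s) by ring, Real.exp_add]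
    ring
  rw [setLIntegral_congr_fun measurableSet_Ioi h1, lintegral_lintegral_swap (by fun_prop)]
  have h2 : ∀ y ∈ Set.Ioi (0 : ℝ), ∫⁻ s in Set.Ioi (0 : ℝ), ENNReal.ofReal (1 / Real.Gamma (a + b)) *
        (ENNReal.ofReal (y ^ (a + b - 1) * Real.exp (-y)) *
        ENNReal.ofReal (s ^ (a - 1) * Real.exp (-(y * s)))) =
      ENNReal.ofReal (Real.Gamma a / Real.Gamma (a + b)) *
        ENNReal.ofReal (y ^ (b - 1) * Real.exp (-(1 * y))) := by
    intro y (hy : 0 < y)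
    rw [lintegral_const_mul _ (by fun_prop), lintegral_const_mul _ (by fun_prop),
      lintegral_rpow_mul_exp_neg ha hy, ← ENNReal.ofReal_mul (by positivity),
      ← ENNReal.ofReal_mul (by positivity), ← ENNReal.ofReal_mul (by positivity)]
    congr 1
    have : y ^ (a + b - 1) = y ^ (b - 1) * y ^ a := by
      rw [← Real.rpow_add hy]; congr 1; ring
    rw [this, Real.rpow_neg hy.le, one_mul]
    field_simp
  rw [setLIntegral_congr_fun measurableSet_Ioi h2, lintegral_const_mul _ (by fun_prop),
    lintegral_rpow_mul_exp_neg hb one_pos, ← ENNReal.ofReal_mul (by positivity), Real.one_rpow]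
  congr 1
  ring

/-- The fundamental theorem of calculus for a function with nonnegative derivative on the open
interval, without integrability assumptions. -/
lemma lintegral_Ioc_deriv {F f : ℝ → ℝ} {s : ℝ} (hs : 0 ≤ s) (hF : ContinuousOn F (Set.Icc 0 s))
    (hd : ∀ r ∈ Set.Ioo 0 s, HasDerivAt F (f r) r) (hf : ∀ r ∈ Set.Ioo 0 s, 0 ≤ f r) :
    ∫⁻ r in Set.Ioc 0 s, ENNReal.ofReal (f r) = ENNReal.ofReal (F s - F 0) := by
  have hi : IntegrableOn f (Set.Ioc 0 s) :=
    intervalIntegral.integrableOn_deriv_of_nonneg hF hd hf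
  rw [← intervalIntegral.integral_eq_sub_of_hasDerivAt_of_le hs hF hd
    ((intervalIntegrable_iff_integrableOn_Ioc_of_le hs).2 hi),
    intervalIntegral.integral_of_le hs, ofReal_integral_eq_lintegral_ofReal hi]
  rw [← restrict_Ioo_eq_restrict_Ioc]
  filter_upwards [ae_restrict_mem measurableSet_Ioo] with r hr using hf r hr

/-- For positive `T` and `N`, `T⁻ᴺ` is a mixture of the functions `T ↦ e^{-sT}`; for `T = ∞` both
sides vanish. -/
lemma lintegral_rpow_mul_expNeg {N : ℕ} (hN : 1 ≤ N) {T : ℝ≥0∞} (hT : T ≠ 0) :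
    ∫⁻ s in Set.Ioi (0 : ℝ), ENNReal.ofReal (s ^ ((N : ℝ) - 1) / Real.Gamma N) *
      expNeg (ENNReal.ofReal s * T) = T⁻¹ ^ N := by
  have hN' : (0 : ℝ) < N := by exact_mod_cast hN
  have hG := Real.Gamma_pos_of_pos hN'
  rcases eq_or_ne T ∞ with rfl | hT'
  · rw [ENNReal.inv_top, zero_pow (by omega), setLIntegral_congr_fun (g := fun _ => 0) measurableSet_Ioi]
    · simp
    · intro s (hs : 0 < s)
      simp [ENNReal.mul_top, hs]
  · have ht : 0 < T.toReal := ENNReal.toReal_pos hT hT'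
    have h1 : ∀ s ∈ Set.Ioi (0 : ℝ), ENNReal.ofReal (s ^ ((N : ℝ) - 1) / Real.Gamma N) *
        expNeg (ENNReal.ofReal s * T) = ENNReal.ofReal (1 / Real.Gamma N) *
        ENNReal.ofReal (s ^ ((N : ℝ) - 1) * Real.exp (-(T.toReal * s))) := by
      intro s (hs : 0 < s)
      rw [← ENNReal.ofReal_toReal hT', ← ENNReal.ofReal_mul hs.le, expNeg_ofReal (by positivity),
        ← ENNReal.ofReal_mul (by positivity), ← ENNReal.ofReal_mul (by positivity),
        ENNReal.toReal_ofReal ht.le]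
      congr 1
      rw [mul_comm s]
      ring
    rw [setLIntegral_congr_fun measurableSet_Ioi h1, lintegral_const_mul _ (by fun_prop),
      lintegral_rpow_mul_exp_neg hN' ht, ← ENNReal.ofReal_mul (by positivity), Real.rpow_neg ht.le,
      Real.rpow_natCast]
    have : 1 / Real.Gamma N * (Real.Gamma N * (T.toReal ^ N)⁻¹) = (T.toReal⁻¹) ^ N := by
      rw [inv_pow]
      field_simp
    rw [this, ENNReal.ofReal_pow (by positivity), ENNReal.ofReal_inv_of_pos ht,
      ENNReal.ofReal_toReal hT']

/-! ### Normalised points of a Poisson process -/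

section Normalised

variable {Ω : Type*} [MeasurableSpace Ω] {P : Measure Ω} {ν : Measure ℝ} {J : ℕ → Ω → ℝ}

/-- The sum of the positive points of the configuration. -/
def totalMass (J : ℕ → Ω → ℝ) (ω : Ω) : ℝ≥0∞ := ∑' ℓ, ENNReal.ofReal (J ℓ ω)

/-- The linear function `x ↦ s⁺ x⁺`. -/
def linearTilt (s x : ℝ) : ℝ≥0∞ := ENNReal.ofReal s * ENNReal.ofReal x

lemma measurable_linearTilt (s : ℝ) : Measurable (linearTilt s) := by unfold linearTilt; fun_prop

lemma measurable_totalMass (hJ : ∀ ℓ, Measurable (J ℓ)) : Measurable (totalMass J) :=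
  Measurable.tsum fun ℓ => (hJ ℓ).ennreal_ofReal

/-- The expected distinct-index sum of the normalised points, as an integral over the scale
variable `s` that linearises the normalisation. -/
theorem IsPoissonEnumeration.lintegral_distinctSum_normalised [IsProbabilityMeasure P]
    (h : IsPoissonEnumeration ν J P) {k : ℕ} (c : Fin k → ℕ) (hc : ∀ i, 1 ≤ c i)
    (hN : 1 ≤ ∑ i, c i) (hT : ∀ᵐ ω ∂P, totalMass J ω ≠ 0)
    (hM : ∀ s, 0 < s → ∀ m, 1 ≤ m → tiltedMoment ν (linearTilt s) m ≠ ∞)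
    (hψ : ∀ s, 0 < s → laplaceExponent ν (linearTilt s) ≠ ∞) :
    ∫⁻ ω, distinctSum (fun ℓ => (totalMass J ω)⁻¹ * ENNReal.ofReal (J ℓ ω)) c ∂P =
      ∫⁻ s in Set.Ioi (0 : ℝ), ENNReal.ofReal (s ^ (((∑ i, c i : ℕ) : ℝ) - 1) /
        Real.Gamma (∑ i, c i : ℕ)) *
        ((∏ i, tiltedMoment ν (linearTilt s) (c i)) * expNeg (laplaceExponent ν (linearTilt s))) := by
  set N := ∑ i, c i with hNdef
  have hmJ := h.measurable
  have hmT := measurable_totalMass hmJ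
  have hmD : Measurable fun ω => distinctSum (fun ℓ => ENNReal.ofReal (J ℓ ω)) c :=
    (measurable_distinctSum c).comp (measurable_pi_lambda _ fun ℓ => (hmJ ℓ).ennreal_ofReal)
  have h1 : ∀ᵐ ω ∂P, distinctSum (fun ℓ => (totalMass J ω)⁻¹ * ENNReal.ofReal (J ℓ ω)) c =
      ∫⁻ s in Set.Ioi (0 : ℝ), ENNReal.ofReal (s ^ ((N : ℝ) - 1) / Real.Gamma N) *
        (distinctSum (fun ℓ => ENNReal.ofReal (J ℓ ω)) c *
          expNeg (ENNReal.ofReal s * totalMass J ω)) := by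
    filter_upwards [hT] with ω hω
    rw [distinctSum_const_mul, ← hNdef, ← lintegral_rpow_mul_expNeg hN hω,
      ← lintegral_mul_const _ (by fun_prop)]
    refine lintegral_congr fun s => ?_
    ring
  rw [lintegral_congr_ae h1, lintegral_lintegral_swap (by fun_prop)]
  refine setLIntegral_congr_fun measurableSet_Ioi fun s (hs : 0 < s) => ?_
  rw [lintegral_const_mul _ (by fun_prop), ← h.lintegral_distinctSum_mul_expNeg c hc
    (measurable_linearTilt s) (hM s hs) (hψ s hs)]
  simp only [totalMass, pointSum, linearTilt, ENNReal.tsum_mul_left]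

/-- The Laplace exponent is the integral of its derivative, the first tilted moment. -/
lemma laplaceExponent_linearTilt [SFinite ν] {s : ℝ} (hs : 0 < s) :
    laplaceExponent ν (linearTilt s) = ∫⁻ r in Set.Ioc 0 s, tiltedMoment ν (linearTilt r) 1 := by
  unfold laplaceExponent tiltedMoment linearTilt
  rw [lintegral_lintegral_swap (by fun_prop)]
  refine lintegral_congr fun x => ?_
  rcases le_or_gt x 0 with hx | hx
  · simp [ENNReal.ofReal_of_nonpos hx]
  have h1 := lintegral_Ioc_deriv (F := fun r => - Real.exp (-(r * x)))
    (f := fun r => Real.exp (-(r * x)) * x) hs.le (by fun_prop) (fun r _ => by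
      have := (((((hasDerivAt_id r).mul_const x).fun_neg).exp).fun_neg)
      simpa using this) (fun r _ => by positivity)
  rw [← ENNReal.ofReal_mul hs.le, expNeg_ofReal (by positivity), ← ENNReal.ofReal_one,
    ← ENNReal.ofReal_sub _ (by positivity)]
  have h2 : Real.exp (-(0 * x)) = 1 := by simp
  simp only [h2] at h1
  rw [show 1 - Real.exp (-(s * x)) = -Real.exp (-(s * x)) - -1 by ring, ← h1]
  refine setLIntegral_congr_fun measurableSet_Ioc fun r hr => ?_
  have hr0 : 0 < r := hr.1
  rw [← ENNReal.ofReal_mul hr0.le, expNeg_ofReal (by positivity), pow_one,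
    ENNReal.ofReal_mul (by positivity)]

end Normalised

/-! ### Rising factorials and the Ewens–Pitman weights -/

lemma risingFactorial_succ (x : ℝ) (m : ℕ) (a : ℝ) :
    risingFactorial x (m + 1) a = risingFactorial x m a * (x + m * a) :=
  Finset.prod_range_succ _ _

lemma risingFactorial_succ' (x : ℝ) (m : ℕ) (a : ℝ) :
    risingFactorial x (m + 1) a = x * risingFactorial (x + a) m a := by
  unfold risingFactorial
  rw [Finset.prod_range_succ', mul_comm]
  congr 1
  · simp
  · refine Finset.prod_congr rfl fun i _ => ?_
    push_cast; ring

@[simp] lemma risingFactorial_zero (x a : ℝ) : risingFactorial x 0 a = 1 := by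
  simp [risingFactorial]

lemma risingFactorial_pos {x a : ℝ} (hx : 0 < x) (ha : 0 ≤ a) (m : ℕ) : 0 < risingFactorial x m a :=
  Finset.prod_pos fun i _ => by positivity

lemma Gamma_add_natCast {x : ℝ} (hx : 0 < x) (m : ℕ) :
    Real.Gamma (x + m) = risingFactorial x m 1 * Real.Gamma x := by
  induction m with
  | zero => simp
  | succ m ih =>
    rw [Nat.cast_succ, ← add_assoc, Real.Gamma_add_one (by positivity), ih, risingFactorial_succ]
    ring

lemma risingFactorial_mul (a x : ℝ) (m : ℕ) :
    risingFactorial (a * x) m a = a ^ m * risingFactorial x m 1 := by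
  induction m with
  | zero => simp
  | succ m ih => rw [risingFactorial_succ, ih, risingFactorial_succ]; ring

lemma risingFactorial_zero_right (x : ℝ) (m : ℕ) : risingFactorial x m 0 = x ^ m := by
  simp [risingFactorial]

/-- The Ewens–Pitman weight of a composition `(c_1, …, c_k)`, i.e. the probability that a `PD(α, θ)`
partition equals a given partition with block sizes `c_1, …, c_k`. -/
def pitmanWeight {k : ℕ} (α θ : ℝ) (c : Fin k → ℕ) : ℝ :=
  risingFactorial (θ + α) (k - 1) α * (∏ i, risingFactorial (1 - α) (c i - 1) 1) /
    risingFactorial (θ + 1) (∑ i, c i - 1) 1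

/-! ### The stable and gamma Lévy measures -/

instance (α : ℝ) : SFinite (stableLevyMeasure α) := by unfold stableLevyMeasure; infer_instance

instance (θ : ℝ) : SFinite (gammaLevyMeasure θ) := by unfold gammaLevyMeasure; infer_instance

lemma lintegral_stableLevyMeasure (α : ℝ) {f : ℝ → ℝ≥0∞} (hf : Measurable f) :
    ∫⁻ x, f x ∂(stableLevyMeasure α) =
      ∫⁻ x in Set.Ioi 0, ENNReal.ofReal (α * x ^ (-α - 1)) * f x := by
  unfold stableLevyMeasure
  rw [lintegral_withDensity_eq_lintegral_mul _ (by fun_prop) hf]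
  rfl

lemma lintegral_gammaLevyMeasure (θ : ℝ) {f : ℝ → ℝ≥0∞} (hf : Measurable f) :
    ∫⁻ x, f x ∂(gammaLevyMeasure θ) =
      ∫⁻ x in Set.Ioi 0, ENNReal.ofReal (θ * x⁻¹ * Real.exp (-x)) * f x := by
  unfold gammaLevyMeasure
  rw [lintegral_withDensity_eq_lintegral_mul _ (by fun_prop) hf]
  rfl

lemma tiltedMoment_stable {α s : ℝ} (h0 : 0 < α) (h1 : α < 1) (hs : 0 < s) {m : ℕ} (hm : 1 ≤ m) :
    tiltedMoment (stableLevyMeasure α) (linearTilt s) m =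
      ENNReal.ofReal (α * Real.Gamma (m - α) * s ^ (α - m)) := by
  have hm' : (1 : ℝ) ≤ m := by exact_mod_cast hm
  have hmα : 0 < m - α := by linarith
  unfold tiltedMoment linearTilt
  rw [lintegral_stableLevyMeasure _ (by fun_prop), mul_assoc, ENNReal.ofReal_mul h0.le,
    ← neg_sub (m : ℝ) α, ← lintegral_rpow_mul_exp_neg hmα hs, ← lintegral_const_mul _ (by fun_prop)]
  refine setLIntegral_congr_fun measurableSet_Ioi fun x (hx : 0 < x) => ?_
  rw [← ENNReal.ofReal_mul hs.le, expNeg_ofReal (by positivity), ← ENNReal.ofReal_pow hx.le,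
    ← ENNReal.ofReal_mul (by positivity), ← ENNReal.ofReal_mul (by positivity),
    ← ENNReal.ofReal_mul (by positivity)]
  congr 1
  rw [show (m : ℝ) - α - 1 = (-α - 1) + m by ring, Real.rpow_add hx, Real.rpow_natCast]
  ring

lemma laplaceExponent_stable {α s : ℝ} (h0 : 0 < α) (h1 : α < 1) (hs : 0 < s) :
    laplaceExponent (stableLevyMeasure α) (linearTilt s) =
      ENNReal.ofReal (Real.Gamma (1 - α) * s ^ α) := by
  have hG := Real.Gamma_pos_of_pos (sub_pos.2 h1)
  rw [laplaceExponent_linearTilt hs]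
  have h2 := lintegral_Ioc_deriv (F := fun r => Real.Gamma (1 - α) * r ^ α)
    (f := fun r => α * Real.Gamma (1 - α) * r ^ (α - 1)) hs.le
    (continuousOn_const.mul (continuousOn_id.rpow_const fun _ _ => Or.inr h0.le))
    (fun r hr => by
      refine ((Real.hasDerivAt_rpow_const (Or.inl hr.1.ne')).const_mul _).congr_deriv ?_
      ring) (fun r hr => by have := hr.1; positivity)
  rw [Real.zero_rpow h0.ne', mul_zero, sub_zero] at h2
  rw [← h2]
  refine setLIntegral_congr_fun measurableSet_Ioc fun r hr => ?_
  simpa using tiltedMoment_stable h0 h1 hr.1 le_rfl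

lemma tiltedMoment_gamma {θ s : ℝ} (h0 : 0 < θ) (hs : 0 < s) {m : ℕ} (hm : 1 ≤ m) :
    tiltedMoment (gammaLevyMeasure θ) (linearTilt s) m =
      ENNReal.ofReal (θ * Real.Gamma m * (1 + s) ^ (-(m : ℝ))) := by
  have hm' : (0 : ℝ) < m := by exact_mod_cast hm
  unfold tiltedMoment linearTilt
  rw [lintegral_gammaLevyMeasure _ (by fun_prop), mul_assoc, ENNReal.ofReal_mul h0.le,
    ← lintegral_rpow_mul_exp_neg hm' (by positivity), ← lintegral_const_mul _ (by fun_prop)]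
  refine setLIntegral_congr_fun measurableSet_Ioi fun x (hx : 0 < x) => ?_
  rw [← ENNReal.ofReal_mul hs.le, expNeg_ofReal (by positivity), ← ENNReal.ofReal_pow hx.le,
    ← ENNReal.ofReal_mul (by positivity), ← ENNReal.ofReal_mul (by positivity),
    ← ENNReal.ofReal_mul (by positivity)]
  congr 1
  rw [Real.rpow_sub_one hx.ne', Real.rpow_natCast, show -((1 + s) * x) = -x + -(s * x) by ring,
    Real.exp_add]
  ring

lemma laplaceExponent_gamma {θ s : ℝ} (h0 : 0 < θ) (hs : 0 < s) :
    laplaceExponent (gammaLevyMeasure θ) (linearTilt s) = ENNReal.ofReal (θ * Real.log (1 + s)) := by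
  rw [laplaceExponent_linearTilt hs]
  have hpos : ∀ r ∈ Set.Icc 0 s, (1 : ℝ) + r ≠ 0 := fun r hr => by have := hr.1; positivity
  have h2 := lintegral_Ioc_deriv (F := fun r => θ * Real.log (1 + r))
    (f := fun r => θ * (1 + r)⁻¹) hs.le
    (continuousOn_const.mul (ContinuousOn.log (by fun_prop) hpos))
    (fun r hr => by
      have := (((hasDerivAt_id r).const_add 1).log (hpos r ⟨hr.1.le, hr.2.le⟩)).const_mul θ
      simpa using this) (fun r hr => by have := hr.1; positivity)
  rw [add_zero, Real.log_one, mul_zero, sub_zero] at h2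
  rw [← h2]
  refine setLIntegral_congr_fun measurableSet_Ioc fun r hr => ?_
  have := tiltedMoment_gamma (θ := θ) h0 hr.1 le_rfl
  simpa [Real.rpow_neg_one] using this

lemma prod_rpow_eq {k : ℕ} (c : Fin k → ℕ) {x : ℝ} (hx : 0 < x) (α : ℝ) :
    ∏ i, x ^ (α - c i) = x ^ (k * α - (∑ i, c i : ℕ)) := by
  rw [← Real.rpow_sum_of_pos hx]
  congr 1
  simp [Finset.sum_sub_distrib]

section Expected

variable {Ω : Type*} [MeasurableSpace Ω] {P : Measure Ω} {J : ℕ → Ω → ℝ}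

/-- For the stable Lévy measure the expected distinct-index sums of the normalised points are the
Ewens–Pitman weights with parameters `(α, 0)`: the integral over the scale variable is a Gamma
integral in `s ^ α`. -/
theorem lintegral_distinctSum_stable [IsProbabilityMeasure P] {α : ℝ} (h0 : 0 < α) (h1 : α < 1)
    (h : IsPoissonEnumeration (stableLevyMeasure α) J P) (hT : ∀ᵐ ω ∂P, totalMass J ω ≠ 0)
    {k : ℕ} (hk : 1 ≤ k) (c : Fin k → ℕ) (hc : ∀ i, 1 ≤ c i) :
    ∫⁻ ω, distinctSum (fun ℓ => (totalMass J ω)⁻¹ * ENNReal.ofReal (J ℓ ω)) c ∂P =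
      ENNReal.ofReal (pitmanWeight α 0 c) := by
  have hkN : k ≤ ∑ i, c i := by
    simpa using Finset.sum_le_sum fun i (_ : i ∈ Finset.univ) => hc i
  rw [h.lintegral_distinctSum_normalised c hc (hk.trans hkN) hT
    (fun s hs m hm => by rw [tiltedMoment_stable h0 h1 hs hm]; simp)
    (fun s hs => by rw [laplaceExponent_stable h0 h1 hs]; simp)]
  set N := ∑ i, c i with hN
  have hN1 : 1 ≤ N := hk.trans hkN
  have hb := Real.Gamma_pos_of_pos (sub_pos.2 h1)
  set b := Real.Gamma (1 - α) with hbdef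
  have hGc : ∀ i, Real.Gamma (c i - α) = risingFactorial (1 - α) (c i - 1) 1 * b := by
    intro i
    rw [← Gamma_add_natCast (sub_pos.2 h1), Nat.cast_sub (hc i)]
    congr 1; push_cast; ring
  have hGN : Real.Gamma N = risingFactorial 1 (N - 1) 1 := by
    have := Gamma_add_natCast one_pos (N - 1)
    rw [Real.Gamma_one, mul_one, Nat.cast_sub hN1] at this
    rw [← this]; congr 1; push_cast; ring
  have hGk : Real.Gamma k = risingFactorial 1 (k - 1) 1 := by
    have := Gamma_add_natCast one_pos (k - 1)
    rw [Real.Gamma_one, mul_one, Nat.cast_sub hk] at this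
    rw [← this]; congr 1; push_cast; ring
  have hk0 : (0 : ℝ) < k := by exact_mod_cast hk
  have hrN := risingFactorial_pos one_pos zero_le_one (N - 1)
  have hrk := risingFactorial_pos one_pos zero_le_one (k - 1)
  have hrc : ∀ i, 0 < risingFactorial (1 - α) (c i - 1) 1 := fun i =>
    risingFactorial_pos (sub_pos.2 h1) zero_le_one _
  set Q := ∏ i, risingFactorial (1 - α) (c i - 1) 1 with hQ
  have hQ0 : 0 < Q := Finset.prod_pos fun i _ => hrc i
  have h2 : ∀ s ∈ Set.Ioi (0 : ℝ), ENNReal.ofReal (s ^ ((N : ℝ) - 1) / Real.Gamma N) *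
      ((∏ i, tiltedMoment (stableLevyMeasure α) (linearTilt s) (c i)) *
        expNeg (laplaceExponent (stableLevyMeasure α) (linearTilt s))) =
      ENNReal.ofReal (α ^ k * b ^ k * Q / risingFactorial 1 (N - 1) 1) *
        ENNReal.ofReal (s ^ (k * α - 1) * Real.exp (-b * s ^ α)) := by
    intro s (hs : 0 < s)
    have h3 : ∏ i, tiltedMoment (stableLevyMeasure α) (linearTilt s) (c i) =
        ENNReal.ofReal (α ^ k * b ^ k * Q * s ^ (k * α - N)) := by
      simp_rw [fun i => tiltedMoment_stable h0 h1 hs (hc i)]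
      rw [← ENNReal.ofReal_prod_of_nonneg]
      · congr 1
        simp_rw [hGc, Finset.prod_mul_distrib, prod_rpow_eq c hs]
        simp only [Finset.prod_const, Finset.card_univ, Fintype.card_fin]
        rw [← hQ, ← hN]; ring
      · intro i _
        rw [hGc]
        have := hrc i
        positivity
    rw [h3, laplaceExponent_stable h0 h1 hs, ← hbdef, expNeg_ofReal (by positivity), hGN,
      ← ENNReal.ofReal_mul (by positivity), ← ENNReal.ofReal_mul (by positivity),
      ← ENNReal.ofReal_mul (by positivity)]
    congr 1
    rw [show (k : ℝ) * α - 1 = (N - 1) + (k * α - N) by ring, Real.rpow_add hs, neg_mul]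
    field_simp
  have hint := integral_rpow_mul_exp_neg_mul_rpow (p := α) (q := k * α - 1) (b := b) h0
    (by nlinarith) hb
  have hq : ((k : ℝ) * α - 1 + 1) / α = k := by field_simp; ring
  have hq' : -((k : ℝ) * α - 1 + 1) / α = -k := by rw [neg_div, hq]
  rw [hq, hq', hGk, Real.rpow_neg hb.le, Real.rpow_natCast] at hint
  rw [setLIntegral_congr_fun measurableSet_Ioi h2, lintegral_const_mul _ (by fun_prop),
    ← ofReal_integral_eq_lintegral_ofReal, hint, ← ENNReal.ofReal_mul (by positivity)]
  · congr 1
    unfold pitmanWeight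
    have e1 : risingFactorial (0 + α) (k - 1) α = α ^ (k - 1) * risingFactorial 1 (k - 1) 1 := by
      rw [← risingFactorial_mul, mul_one, zero_add]
    have e2 : α ^ k = α ^ (k - 1) * α := by rw [← pow_succ, Nat.sub_add_cancel hk]
    rw [e1, e2, zero_add, ← hQ, ← hN]
    field_simp
  · exact .of_integral_ne_zero (by rw [hint]; positivity)
  · filter_upwards [ae_restrict_mem measurableSet_Ioi] with x (hx : 0 < x)
    positivity

/-- For the gamma Lévy measure the expected distinct-index sums of the normalised points are the
Ewens–Pitman weights with parameters `(0, θ)`: the integral over the scale variable is a beta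
integral of the second kind. -/
theorem lintegral_distinctSum_gamma [IsProbabilityMeasure P] {θ : ℝ} (h0 : 0 < θ)
    (h : IsPoissonEnumeration (gammaLevyMeasure θ) J P) (hT : ∀ᵐ ω ∂P, totalMass J ω ≠ 0)
    {k : ℕ} (hk : 1 ≤ k) (c : Fin k → ℕ) (hc : ∀ i, 1 ≤ c i) :
    ∫⁻ ω, distinctSum (fun ℓ => (totalMass J ω)⁻¹ * ENNReal.ofReal (J ℓ ω)) c ∂P =
      ENNReal.ofReal (pitmanWeight 0 θ c) := by
  have hkN : k ≤ ∑ i, c i := by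
    simpa using Finset.sum_le_sum fun i (_ : i ∈ Finset.univ) => hc i
  rw [h.lintegral_distinctSum_normalised c hc (hk.trans hkN) hT
    (fun s hs m hm => by rw [tiltedMoment_gamma h0 hs hm]; simp)
    (fun s hs => by rw [laplaceExponent_gamma h0 hs]; simp)]
  set N := ∑ i, c i with hN
  have hN1 : 1 ≤ N := hk.trans hkN
  have hN0 : (0 : ℝ) < N := by exact_mod_cast hN1
  have hGc : ∀ i, Real.Gamma (c i) = risingFactorial 1 (c i - 1) 1 := by
    intro i
    have := Gamma_add_natCast one_pos (c i - 1)
    rw [Real.Gamma_one, mul_one, Nat.cast_sub (hc i)] at this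
    rw [← this]; congr 1; push_cast; ring
  have hGN : Real.Gamma (N + θ) = risingFactorial (θ + 1) (N - 1) 1 * (θ * Real.Gamma θ) := by
    rw [← Real.Gamma_add_one h0.ne', ← Gamma_add_natCast (by positivity), Nat.cast_sub hN1]
    congr 1; push_cast; ring
  have hrN : 0 < risingFactorial (θ + 1) (N - 1) 1 :=
    risingFactorial_pos (by positivity) zero_le_one (N - 1)
  have hrc : ∀ i, 0 < risingFactorial 1 (c i - 1) 1 := fun i =>
    risingFactorial_pos one_pos zero_le_one _
  have hGN0 := Real.Gamma_pos_of_pos hN0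
  have hGθ0 := Real.Gamma_pos_of_pos h0
  set Q := ∏ i, risingFactorial 1 (c i - 1) 1 with hQ
  have hQ0 : 0 < Q := Finset.prod_pos fun i _ => hrc i
  have h2 : ∀ s ∈ Set.Ioi (0 : ℝ), ENNReal.ofReal (s ^ ((N : ℝ) - 1) / Real.Gamma N) *
      ((∏ i, tiltedMoment (gammaLevyMeasure θ) (linearTilt s) (c i)) *
        expNeg (laplaceExponent (gammaLevyMeasure θ) (linearTilt s))) =
      ENNReal.ofReal (θ ^ k * Q / Real.Gamma N) *
        ENNReal.ofReal (s ^ ((N : ℝ) - 1) * (1 + s) ^ (-((N : ℝ) + θ))) := by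
    intro s (hs : 0 < s)
    have hs1 : 0 < 1 + s := by positivity
    have h3 : ∏ i, tiltedMoment (gammaLevyMeasure θ) (linearTilt s) (c i) =
        ENNReal.ofReal (θ ^ k * Q * (1 + s) ^ (-(N : ℝ))) := by
      simp_rw [fun i => tiltedMoment_gamma h0 hs (hc i)]
      rw [← ENNReal.ofReal_prod_of_nonneg]
      · congr 1
        have := prod_rpow_eq c hs1 0
        simp only [zero_sub, mul_zero] at this
        simp_rw [hGc, Finset.prod_mul_distrib, this]
        simp only [Finset.prod_const, Finset.card_univ, Fintype.card_fin]
        rw [← hQ, ← hN]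
      · intro i _
        rw [hGc]
        have := hrc i
        positivity
    have hlog : 0 ≤ θ * Real.log (1 + s) := mul_nonneg h0.le (Real.log_nonneg (by linarith))
    have hexp : Real.exp (-(θ * Real.log (1 + s))) = (1 + s) ^ (-θ) := by
      rw [Real.rpow_def_of_pos hs1]; congr 1; ring
    rw [h3, laplaceExponent_gamma h0 hs, expNeg_ofReal hlog, hexp,
      ← ENNReal.ofReal_mul (by positivity), ← ENNReal.ofReal_mul (by positivity),
      ← ENNReal.ofReal_mul (by positivity)]
    congr 1
    rw [neg_add, Real.rpow_add hs1]
    ring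
  rw [setLIntegral_congr_fun measurableSet_Ioi h2, lintegral_const_mul _ (by fun_prop),
    lintegral_rpow_mul_one_add_rpow hN0 h0, ← ENNReal.ofReal_mul (by positivity), hGN]
  congr 1
  unfold pitmanWeight
  have e2 : θ ^ k = θ ^ (k - 1) * θ := by rw [← pow_succ, Nat.sub_add_cancel hk]
  rw [e2, add_zero, sub_zero, risingFactorial_zero_right, ← hQ, ← hN]
  field_simp

end Expected

/-! ### Stick-breaking -/

/-- The joint moments of `x` and `1 - x` under a beta law. -/
lemma lintegral_betaMeasure {a b : ℝ} (ha : 0 < a) (hb : 0 < b) (m r : ℕ) :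
    ∫⁻ x, ENNReal.ofReal x ^ m * ENNReal.ofReal (1 - x) ^ r ∂(betaMeasure a b) =
      ENNReal.ofReal (risingFactorial a m 1 * risingFactorial b r 1 /
        risingFactorial (a + b) (m + r) 1) := by
  have ham : 0 < a + m := by positivity
  have hbr : 0 < b + r := by positivity
  have hmeas : Measurable (betaPDF a b) := (measurable_betaPDFReal a b).ennreal_ofReal
  have hmeas' : Measurable (betaPDF (a + m) (b + r)) := (measurable_betaPDFReal _ _).ennreal_ofReal
  have hB := beta_pos ha hb
  have hB' := beta_pos ham hbr
  have hratio : beta (a + m) (b + r) / beta a b = risingFactorial a m 1 * risingFactorial b r 1 /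
        risingFactorial (a + b) (m + r) 1 := by
    have h := Gamma_add_natCast (x := a + b) (by positivity) (m + r)
    have e : a + m + (b + r) = a + b + ((m + r : ℕ) : ℝ) := by push_cast; ring
    have := risingFactorial_pos (x := a + b) (by positivity) zero_le_one (m + r)
    have := Real.Gamma_pos_of_pos ha
    have := Real.Gamma_pos_of_pos hb
    have := Real.Gamma_pos_of_pos (add_pos ha hb)
    unfold beta
    rw [e, h, Gamma_add_natCast ha, Gamma_add_natCast hb]
    field_simp
  unfold betaMeasure
  rw [lintegral_withDensity_eq_lintegral_mul _ hmeas (by fun_prop)]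
  have h1 : ∀ x, (betaPDF a b * fun x => ENNReal.ofReal x ^ m * ENNReal.ofReal (1 - x) ^ r) x =
      ENNReal.ofReal (beta (a + m) (b + r) / beta a b) * betaPDF (a + m) (b + r) x := by
    intro x
    simp only [Pi.mul_apply, betaPDF_eq]
    split_ifs with hx
    · have h0 := hx.1
      have h1 : 0 < 1 - x := by linarith [hx.2]
      rw [← ENNReal.ofReal_pow h0.le, ← ENNReal.ofReal_pow h1.le, ← ENNReal.ofReal_mul (by positivity),
        ← ENNReal.ofReal_mul (by positivity), ← ENNReal.ofReal_mul (by positivity)]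
      congr 1
      rw [show a + m - 1 = a - 1 + m by ring, show b + r - 1 = b - 1 + r by ring,
        Real.rpow_add h0, Real.rpow_add h1, Real.rpow_natCast, Real.rpow_natCast]
      field_simp
    · simp
  rw [lintegral_congr h1, lintegral_const_mul _ hmeas', lintegral_betaPDF_eq_one ham hbr, mul_one,
    hratio]

lemma ae_betaMeasure_mem_Ioo (a b : ℝ) : ∀ᵐ x ∂(betaMeasure a b), x ∈ Set.Ioo (0 : ℝ) 1 := by
  have hmeas : Measurable (betaPDF a b) := (measurable_betaPDFReal a b).ennreal_ofReal
  unfold betaMeasure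
  rw [ae_withDensity_iff hmeas]
  refine ae_of_all _ fun x hx => ?_
  by_contra h
  refine hx ?_
  rw [betaPDF_eq, if_neg (by exact h), ENNReal.ofReal_zero]

/-- Prepending an entry to a sequence. -/
def seqCons (p : ℝ × (ℕ → ℝ)) : ℕ → ℝ
  | 0 => p.1
  | i + 1 => p.2 i

lemma measurable_seqCons : Measurable seqCons := by
  refine measurable_pi_lambda _ fun i => ?_
  cases i with
  | zero => exact measurable_fst
  | succ i => exact (measurable_pi_apply i).comp measurable_snd

/-- An infinite product measure is the product of its first factor with the product of the
others. -/
lemma map_seqCons_infinitePi (μ : ℕ → Measure ℝ) [∀ i, IsProbabilityMeasure (μ i)] :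
    ((μ 0).prod (Measure.infinitePi fun i => μ (i + 1))).map seqCons = Measure.infinitePi μ := by
  classical
  refine Measure.eq_infinitePi _ fun s t ht => ?_
  -- extend the box by full factors so that its base becomes an initial segment of `ℕ`
  let t' : ℕ → Set ℝ := fun i => if i ∈ s then t i else Set.univ
  have ht' : ∀ i, MeasurableSet (t' i) := by
    intro i
    by_cases hi : i ∈ s
    · simpa [t', hi] using ht i
    · simp [t', hi]
  obtain ⟨N, hN⟩ := s.exists_nat_subset_range
  have hN' : s ⊆ Finset.range (N + 1) :=
    hN.trans (Finset.range_subset_range.2 (Nat.le_succ N))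
  have hset : seqCons ⁻¹' ((s : Set ℕ).pi t) =
      t' 0 ×ˢ ((Finset.range N : Set ℕ).pi fun i => t' (i + 1)) := by
    ext p
    simp only [Set.mem_preimage, Set.mem_pi, Finset.mem_coe, Set.mem_prod, Finset.mem_range]
    constructor
    · intro h
      refine ⟨?_, fun i hi => ?_⟩
      · by_cases h0 : 0 ∈ s
        · simpa [t', h0, seqCons] using h 0 h0
        · simp [t', h0]
      · by_cases h0 : i + 1 ∈ s
        · simpa [t', h0, seqCons] using h (i + 1) h0
        · simp [t', h0]
    · rintro ⟨h0, h1⟩ i hi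
      cases i with
      | zero => simpa [t', hi, seqCons] using h0
      | succ i =>
        have := h1 i (by have := Finset.mem_range.1 (hN' hi); omega)
        simpa [t', hi, seqCons] using this
  have hprod : ∏ i ∈ s, μ i (t i) = ∏ i ∈ Finset.range (N + 1), μ i (t' i) := by
    rw [← Finset.prod_subset hN' (f := fun i => μ i (t' i))]
    · exact Finset.prod_congr rfl fun i hi => by simp [t', hi]
    · intro i _ hi
      simp [t', hi]
  rw [Measure.map_apply measurable_seqCons (.pi s.countable_toSet fun i hi => ht i), hset,
    Measure.prod_prod,
    Measure.infinitePi_pi _ (fun i _ => ht' (i + 1)), hprod, Finset.prod_range_succ', mul_comm]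

section GEM

variable {α θ : ℝ}

lemma isProbabilityMeasure_stick (hα0 : 0 ≤ α) (hα1 : α < 1) (hθα : 0 < θ + α) (ℓ : ℕ) :
    IsProbabilityMeasure (betaMeasure (1 - α) (θ + (ℓ + 1) * α)) := by
  refine isProbabilityMeasureBeta (by linarith) ?_
  have : 0 ≤ ℓ * α := by positivity
  linarith

/-- Independence of the first stick from the remaining ones, whose law is again of stick-breaking
type with `θ` replaced by `θ + α`. -/
lemma stickLaw_eq_map (hα0 : 0 ≤ α) (hα1 : α < 1) (hθα : 0 < θ + α) :
    stickLaw α θ =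
      ((betaMeasure (1 - α) (θ + α)).prod (stickLaw α (θ + α))).map seqCons := by
  have := isProbabilityMeasure_stick hα0 hα1 hθα
  unfold stickLaw
  rw [← map_seqCons_infinitePi]
  have h : ∀ ℓ : ℕ, θ + ((ℓ + 1 : ℕ) + 1) * α = θ + α + (ℓ + 1) * α := by
    intro ℓ; push_cast; ring
  simp only [h, Nat.cast_zero, zero_add, one_mul]

lemma isProbabilityMeasure_stickLaw (hα0 : 0 ≤ α) (hα1 : α < 1) (hθα : 0 < θ + α) :
    IsProbabilityMeasure (stickLaw α θ) := by
  have := isProbabilityMeasure_stick hα0 hα1 hθα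
  unfold stickLaw
  infer_instance

lemma ae_stickLaw_mem_Ioo (hα0 : 0 ≤ α) (hα1 : α < 1) (hθα : 0 < θ + α) :
    ∀ᵐ W ∂(stickLaw α θ), ∀ i, W i ∈ Set.Ioo (0 : ℝ) 1 := by
  have := isProbabilityMeasure_stick hα0 hα1 hθα
  refine ae_all_iff.2 fun i => ?_
  exact (measurePreserving_eval_infinitePi
    (fun ℓ : ℕ => betaMeasure (1 - α) (θ + (ℓ + 1) * α)) i).quasiMeasurePreserving.ae
    (ae_betaMeasure_mem_Ioo _ _)

/-- After `N` steps the remaining stick has length `∏ i < N, (1 - W i)`. -/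
lemma sum_range_stickBreaking (W : ℕ → ℝ) (N : ℕ) :
    ∑ ℓ ∈ Finset.range N, stickBreaking W ℓ = 1 - ∏ i ∈ Finset.range N, (1 - W i) := by
  induction N with
  | zero => simp
  | succ N ih =>
    rw [Finset.sum_range_succ, ih, Finset.prod_range_succ, stickBreaking]
    ring

lemma stickBreaking_nonneg {W : ℕ → ℝ} (hW : ∀ i, W i ∈ Set.Ioo (0 : ℝ) 1) (ℓ : ℕ) :
    0 ≤ stickBreaking W ℓ :=
  mul_nonneg (hW ℓ).1.le (Finset.prod_nonneg fun i _ => by linarith [(hW i).2])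

lemma tsum_stickBreaking_le_one {W : ℕ → ℝ} (hW : ∀ i, W i ∈ Set.Ioo (0 : ℝ) 1) :
    ∑' ℓ, ENNReal.ofReal (stickBreaking W ℓ) ≤ 1 := by
  refine ENNReal.tsum_le_of_sum_range_le fun N => ?_
  rw [← ENNReal.ofReal_sum_of_nonneg fun i _ => stickBreaking_nonneg hW i,
    sum_range_stickBreaking, ENNReal.ofReal_le_one]
  have : 0 ≤ ∏ i ∈ Finset.range N, (1 - W i) :=
    Finset.prod_nonneg fun i _ => by linarith [(hW i).2]
  linarith

lemma stickBreaking_seqCons_zero (p : ℝ × (ℕ → ℝ)) : stickBreaking (seqCons p) 0 = p.1 := by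
  simp [stickBreaking, seqCons]

lemma stickBreaking_seqCons_succ (p : ℝ × (ℕ → ℝ)) (ℓ : ℕ) :
    stickBreaking (seqCons p) (ℓ + 1) = (1 - p.1) * stickBreaking p.2 ℓ := by
  simp only [stickBreaking, Finset.prod_range_succ', seqCons]
  ring

/-- The expected distinct-index sum of the Poisson–Dirichlet frequencies. -/
def stickMoment (α θ : ℝ) {k : ℕ} (c : Fin k → ℕ) : ℝ≥0∞ :=
  ∫⁻ W, distinctSum (fun ℓ => ENNReal.ofReal (stickBreaking W ℓ)) c ∂(stickLaw α θ)

lemma measurable_distinctSum_stickBreaking {k : ℕ} (c : Fin k → ℕ) :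
    Measurable fun W : ℕ → ℝ => distinctSum (fun ℓ => ENNReal.ofReal (stickBreaking W ℓ)) c := by
  have h : Measurable fun (W : ℕ → ℝ) (ℓ : ℕ) => ENNReal.ofReal (stickBreaking W ℓ) := by
    unfold stickBreaking
    fun_prop
  exact (measurable_distinctSum c).comp h

lemma stickMoment_le_one (hα0 : 0 ≤ α) (hα1 : α < 1) (hθα : 0 < θ + α)
    {k : ℕ} (c : Fin k → ℕ) (hc : ∀ i, 1 ≤ c i) : stickMoment α θ c ≤ 1 := by
  have := isProbabilityMeasure_stickLaw hα0 hα1 hθα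
  calc stickMoment α θ c ≤ ∫⁻ _, 1 ∂(stickLaw α θ) := by
        refine lintegral_mono_ae ?_
        filter_upwards [ae_stickLaw_mem_Ioo hα0 hα1 hθα] with W hW
        exact distinctSum_le_one (tsum_stickBreaking_le_one hW) c hc
    _ = 1 := by simp

/-- The recursion obtained by conditioning on the first stick. -/
lemma stickMoment_succ (hα0 : 0 ≤ α) (hα1 : α < 1) (hθα : 0 < θ + α)
    {k : ℕ} (c : Fin (k + 1) → ℕ) :
    stickMoment α θ c =
      ENNReal.ofReal (risingFactorial (θ + α) (∑ i, c i) 1 / risingFactorial (θ + 1) (∑ i, c i) 1) *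
        stickMoment α (θ + α) c +
      ∑ i, ENNReal.ofReal (risingFactorial (1 - α) (c i) 1 *
          risingFactorial (θ + α) (∑ j, c (i.succAbove j)) 1 / risingFactorial (θ + 1) (∑ i, c i) 1) *
        stickMoment α (θ + α) (fun j => c (i.succAbove j)) := by
  have hab : 1 - α + (θ + α) = θ + 1 := by ring
  have h1α : 0 < 1 - α := by linarith
  have := isProbabilityMeasure_stickLaw hα0 hα1 (by linarith : 0 < θ + α + α)
  have hprob := isProbabilityMeasureBeta h1α hθα
  have hm := fun {k : ℕ} (c : Fin k → ℕ) => measurable_distinctSum_stickBreaking c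
  have h1 : stickMoment α θ c = ∫⁻ w, (ENNReal.ofReal (1 - w) ^ (∑ i, c i) * stickMoment α (θ + α) c +
      ∑ i, ENNReal.ofReal w ^ c i * ENNReal.ofReal (1 - w) ^ (∑ j, c (i.succAbove j)) *
        stickMoment α (θ + α) (fun j => c (i.succAbove j))) ∂(betaMeasure (1 - α) (θ + α)) := by
    rw [stickMoment, stickLaw_eq_map hα0 hα1 hθα, lintegral_map (hm c) measurable_seqCons,
      lintegral_prod (fun p => distinctSum (fun ℓ => ENNReal.ofReal (stickBreaking (seqCons p) ℓ)) c)
        ((hm c).comp measurable_seqCons).aemeasurable]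
    refine lintegral_congr_ae ?_
    filter_upwards [ae_betaMeasure_mem_Ioo (1 - α) (θ + α)] with w hw
    have h2 : ∀ W, distinctSum (fun ℓ => ENNReal.ofReal (stickBreaking (seqCons (w, W)) ℓ)) c =
        ENNReal.ofReal (1 - w) ^ (∑ i, c i) *
          distinctSum (fun ℓ => ENNReal.ofReal (stickBreaking W ℓ)) c +
        ∑ i, ENNReal.ofReal w ^ c i * ENNReal.ofReal (1 - w) ^ (∑ j, c (i.succAbove j)) *
          distinctSum (fun ℓ => ENNReal.ofReal (stickBreaking W ℓ)) (fun j => c (i.succAbove j)) := by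
      intro W
      rw [distinctSum_stick _ (fun ℓ => ENNReal.ofReal (stickBreaking W ℓ)) (ENNReal.ofReal (1 - w))
        (fun ℓ => by rw [stickBreaking_seqCons_succ, ENNReal.ofReal_mul (by linarith [hw.2])])]
      simp only [stickBreaking_seqCons_zero, mul_assoc]
    simp_rw [h2]
    rw [lintegral_add_left ((hm c).const_mul _), lintegral_const_mul _ (hm c),
      lintegral_finsetSum _ (fun i _ => (hm _).const_mul _)]
    simp_rw [fun i => lintegral_const_mul (μ := stickLaw α (θ + α))
      (ENNReal.ofReal w ^ c i * ENNReal.ofReal (1 - w) ^ (∑ j, c (i.succAbove j)))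
      (hm fun j => c (i.succAbove j))]
    rfl
  have h3 : ∀ i : Fin (k + 1), c i + ∑ j, c (i.succAbove j) = ∑ i, c i := fun i =>
    (Fin.sum_univ_succAbove c i).symm
  have h4 := lintegral_betaMeasure h1α hθα 0 (∑ i, c i)
  simp only [pow_zero, one_mul, risingFactorial_zero, zero_add, hab] at h4
  have h5 := fun i => lintegral_betaMeasure h1α hθα (c i) (∑ j, c (i.succAbove j))
  simp only [h3, hab] at h5
  rw [h1, lintegral_add_left (by fun_prop), lintegral_mul_const _ (by fun_prop), h4,
    lintegral_finsetSum _ (fun i _ => by fun_prop)]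
  congr 1
  refine Finset.sum_congr rfl fun i _ => ?_
  rw [lintegral_mul_const _ (by fun_prop), h5]

end GEM

/-! ### The Ewens–Pitman weights as Poisson–Dirichlet moments -/

section GEM

variable {α θ : ℝ}

lemma pitmanWeight_nonneg (hα0 : 0 ≤ α) (hα1 : α < 1) (hθα : 0 < θ + α) {k : ℕ} (c : Fin k → ℕ) :
    0 ≤ pitmanWeight α θ c := by
  unfold pitmanWeight
  have := risingFactorial_pos hθα hα0 (k - 1)
  have := risingFactorial_pos (by linarith : 0 < θ + 1) zero_le_one (∑ i, c i - 1)
  have : 0 ≤ ∏ i, risingFactorial (1 - α) (c i - 1) 1 :=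
    Finset.prod_nonneg fun i _ => (risingFactorial_pos (by linarith) zero_le_one _).le
  positivity

/-- For `θ ≠ 0` the numerator and the denominator can both be extended by the factor `θ`. -/
lemma pitmanWeight_of_pos (hθ : 0 < θ) {k : ℕ} (c : Fin k → ℕ) (hc : ∀ i, 1 ≤ c i) :
    pitmanWeight α θ c = risingFactorial θ k α * (∏ i, risingFactorial (1 - α) (c i - 1) 1) /
      risingFactorial θ (∑ i, c i) 1 := by
  unfold pitmanWeight
  cases k with
  | zero => simp
  | succ k =>
    obtain ⟨N, hN⟩ : ∃ N, ∑ i, c i = N + 1 := by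
      refine Nat.exists_eq_add_one.2 ?_
      rw [Fin.sum_univ_succ]
      have := hc 0
      omega
    have := risingFactorial_pos (by linarith : 0 < θ + 1) zero_le_one N
    rw [hN, risingFactorial_succ' θ k, risingFactorial_succ' θ N, Nat.add_sub_cancel,
      Nat.add_sub_cancel]
    field_simp

/-- The Ewens–Pitman weights satisfy the recursion of `stickMoment_succ`. -/
lemma pitmanWeight_succ (hα1 : α < 1) (hθα : 0 < θ + α) {k : ℕ}
    (c : Fin (k + 1) → ℕ) (hc : ∀ i, 1 ≤ c i) :
    pitmanWeight α θ c =
      risingFactorial (θ + α) (∑ i, c i) 1 / risingFactorial (θ + 1) (∑ i, c i) 1 *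
        pitmanWeight α (θ + α) c +
      ∑ i, risingFactorial (1 - α) (c i) 1 *
          risingFactorial (θ + α) (∑ j, c (i.succAbove j)) 1 / risingFactorial (θ + 1) (∑ i, c i) 1 *
        pitmanWeight α (θ + α) (fun j => c (i.succAbove j)) := by
  have h1α : 0 < 1 - α := by linarith
  have hθ1 : 0 < θ + 1 := by linarith
  obtain ⟨N, hN⟩ : ∃ N, ∑ i, c i = N + 1 := by
    refine Nat.exists_eq_add_one.2 ?_
    rw [Fin.sum_univ_succ]
    have := hc 0
    omega
  rw [pitmanWeight_of_pos hθα c hc]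
  simp_rw [fun i : Fin (k + 1) => pitmanWeight_of_pos (α := α) hθα (fun j => c (i.succAbove j))
    (fun j => hc _)]
  set Q := ∏ i, risingFactorial (1 - α) (c i - 1) 1 with hQ
  have hD := risingFactorial_pos hθ1 zero_le_one N
  have hθN : 0 < θ + 1 + N := by positivity
  have hterm : ∀ i, risingFactorial (1 - α) (c i) 1 *
      risingFactorial (θ + α) (∑ j, c (i.succAbove j)) 1 / risingFactorial (θ + 1) (∑ i, c i) 1 *
      (risingFactorial (θ + α) k α * (∏ j, risingFactorial (1 - α) (c (i.succAbove j) - 1) 1) /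
      risingFactorial (θ + α) (∑ j, c (i.succAbove j)) 1) =
      risingFactorial (θ + α) k α * Q / risingFactorial (θ + 1) (∑ i, c i) 1 * (c i - α) := by
    intro i
    have h1 := risingFactorial_pos hθα zero_le_one (∑ j, c (i.succAbove j))
    have h2 : risingFactorial (1 - α) (c i) 1 =
        risingFactorial (1 - α) (c i - 1) 1 * (c i - α) := by
      obtain ⟨m, hm⟩ := Nat.exists_eq_add_one.2 (hc i)
      rw [hm, risingFactorial_succ, Nat.add_sub_cancel]
      push_cast; ring
    rw [h2, hQ, Fin.prod_univ_succAbove _ i]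
    field_simp
  have h3 := risingFactorial_pos hθα zero_le_one (∑ i, c i)
  rw [Finset.sum_congr rfl fun i _ => hterm i, ← Finset.mul_sum, Finset.sum_sub_distrib,
    ← Nat.cast_sum, hN]
  rw [hN] at h3
  unfold pitmanWeight
  rw [hN, Nat.add_sub_cancel, Nat.add_sub_cancel, risingFactorial_succ (θ + 1) N,
    risingFactorial_succ (θ + α) k, ← hQ]
  simp only [Finset.sum_const, Finset.card_univ, Fintype.card_fin, nsmul_eq_mul]
  push_cast
  field_simp
  ring

lemma risingFactorial_le_risingFactorial {x y : ℝ} (hx : 0 ≤ x) (hxy : x ≤ y) {a b : ℝ} (ha : 0 ≤ a)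
    (hab : a ≤ b) (m : ℕ) : risingFactorial x m a ≤ risingFactorial y m b :=
  Finset.prod_le_prod (fun i _ => by positivity) fun i _ => by gcongr

/-- A bound on the weights that does not depend on `θ`. -/
lemma pitmanWeight_le (hα0 : 0 ≤ α) (hα1 : α < 1) (hθ : 0 ≤ θ) (hθα : 0 < θ + α) {k : ℕ}
    (c : Fin k → ℕ) (hc : ∀ i, 1 ≤ c i) :
    pitmanWeight α θ c ≤ ∏ i, risingFactorial (1 - α) (c i - 1) 1 := by
  have hQ : 0 ≤ ∏ i, risingFactorial (1 - α) (c i - 1) 1 :=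
    Finset.prod_nonneg fun i _ => (risingFactorial_pos (by linarith) zero_le_one _).le
  have hkN : k ≤ ∑ i, c i := by
    simpa using Finset.sum_le_sum fun i (_ : i ∈ Finset.univ) => hc i
  have h1 := risingFactorial_pos (by linarith : 0 < θ + 1) zero_le_one (∑ i, c i - 1)
  have h2 : risingFactorial (θ + α) (k - 1) α ≤ risingFactorial (θ + 1) (∑ i, c i - 1) 1 := by
    refine (risingFactorial_le_risingFactorial (y := θ + 1) hθα.le (by linarith) hα0 hα1.le _).trans ?_
    unfold risingFactorial
    refine Finset.prod_le_prod_of_subset_of_one_le (Finset.range_subset_range.2 (by omega))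
      (fun i _ => by positivity) fun i _ _ => ?_
    have : (0 : ℝ) ≤ i := by positivity
    linarith
  unfold pitmanWeight
  rw [div_le_iff₀ h1, mul_comm]
  gcongr

/-- The coefficient of the same composition in the first-stick recursion, bounded in a form whose
infinite product along `θ, θ + α, θ + 2α, …` is visibly `0`. -/
lemma risingFactorial_div_le_exp (hα1 : α < 1) (hθα : 0 < θ + α) {N : ℕ} (hN : 1 ≤ N) :
    risingFactorial (θ + α) N 1 / risingFactorial (θ + 1) N 1 ≤
      Real.exp (-((1 - α) / (θ + 1))) := by
  obtain ⟨N, rfl⟩ := Nat.exists_eq_add_one.2 hN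
  have hθ1 : 0 < θ + 1 := by linarith
  have h1 := risingFactorial_pos (by linarith : 0 < θ + 1 + 1) zero_le_one N
  have h2 := risingFactorial_le_risingFactorial (x := θ + α + 1) (y := θ + 1 + 1)
    (by linarith) (by linarith) zero_le_one le_rfl N
  rw [risingFactorial_succ', risingFactorial_succ']
  calc (θ + α) * risingFactorial (θ + α + 1) N 1 / ((θ + 1) * risingFactorial (θ + 1 + 1) N 1)
      ≤ (θ + α) * risingFactorial (θ + 1 + 1) N 1 / ((θ + 1) * risingFactorial (θ + 1 + 1) N 1) := by
        gcongr
    _ = -((1 - α) / (θ + 1)) + 1 := by field_simp; ring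
    _ ≤ _ := Real.add_one_le_exp _

lemma tendsto_sum_div_add_mul (hα0 : 0 ≤ α) (hα1 : α < 1) (hθ : 0 ≤ θ) :
    Tendsto (fun N => ∑ j ∈ Finset.range N, (1 - α) / (θ + j * α + 1)) atTop atTop := by
  have h1α : 0 < 1 - α := by linarith
  have hC : 0 < (1 - α) / (θ + 1) := by positivity
  refine tendsto_atTop_mono (fun N => ?_)
    (Real.tendsto_sum_range_one_div_nat_succ_atTop.const_mul_atTop hC)
  rw [Finset.mul_sum]
  refine Finset.sum_le_sum fun j _ => ?_
  rw [← mul_div_assoc, mul_one, div_div]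
  have hj : (0 : ℝ) ≤ j := by positivity
  gcongr
  nlinarith

/-- The expected distinct-index sums of the Poisson–Dirichlet frequencies are the Ewens–Pitman
weights: both satisfy the first-stick recursion, whose coefficient at the same composition has
infinite product `0`. -/
theorem stickMoment_eq (hα0 : 0 ≤ α) (hα1 : α < 1) (hθ : 0 ≤ θ) (hθα : 0 < θ + α) {k : ℕ}
    (c : Fin k → ℕ) (hc : ∀ i, 1 ≤ c i) :
    stickMoment α θ c = ENNReal.ofReal (pitmanWeight α θ c) := by
  suffices h : (stickMoment α θ c).toReal = pitmanWeight α θ c by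
    rw [← h, ENNReal.ofReal_toReal]
    exact ne_top_of_le_ne_top ENNReal.one_ne_top (stickMoment_le_one hα0 hα1 hθα c hc)
  induction k generalizing θ with
  | zero =>
    have := isProbabilityMeasure_stickLaw hα0 hα1 hθα
    simp [stickMoment, distinctSum_of_isEmpty, pitmanWeight]
  | succ k ih =>
    have hN : 1 ≤ ∑ i, c i := by
      rw [Fin.sum_univ_succ]
      have := hc 0
      omega
    -- the distance between the two sides contracts along the recursion
    have hstep : ∀ θ, 0 ≤ θ → 0 < θ + α →
        |(stickMoment α θ c).toReal - pitmanWeight α θ c| ≤ Real.exp (-((1 - α) / (θ + 1))) *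
          |(stickMoment α (θ + α) c).toReal - pitmanWeight α (θ + α) c| := by
      intro θ hθ hθα
      have hne : ∀ {k : ℕ} (c : Fin k → ℕ), (∀ i, 1 ≤ c i) → stickMoment α (θ + α) c ≠ ∞ :=
        fun c hc => ne_top_of_le_ne_top ENNReal.one_ne_top
          (stickMoment_le_one hα0 hα1 (by linarith) c hc)
      have hr : ∀ m, 0 < risingFactorial (θ + α) m 1 := risingFactorial_pos hθα zero_le_one
      have hr1 : ∀ m, 0 < risingFactorial (θ + 1) m 1 :=
        risingFactorial_pos (by linarith) zero_le_one
      have hra : ∀ m, 0 < risingFactorial (1 - α) m 1 :=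
        risingFactorial_pos (by linarith) zero_le_one
      have h1 := congrArg ENNReal.toReal (stickMoment_succ hα0 hα1 hθα c)
      rw [ENNReal.toReal_add (ENNReal.mul_ne_top (by simp) (hne c hc))
        (ENNReal.sum_ne_top.2 fun i _ => ENNReal.mul_ne_top (by simp) (hne _ fun j => hc _)),
        ENNReal.toReal_sum fun i _ => ENNReal.mul_ne_top (by simp) (hne _ fun j => hc _)] at h1
      simp only [ENNReal.toReal_mul] at h1
      rw [ENNReal.toReal_ofReal (div_pos (hr _) (hr1 _)).le] at h1
      rw [h1, pitmanWeight_succ hα1 hθα c hc]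
      have h2 : ∀ i : Fin (k + 1), (ENNReal.ofReal (risingFactorial (1 - α) (c i) 1 *
          risingFactorial (θ + α) (∑ j, c (i.succAbove j)) 1 /
            risingFactorial (θ + 1) (∑ i, c i) 1)).toReal *
          (stickMoment α (θ + α) (fun j => c (i.succAbove j))).toReal =
          risingFactorial (1 - α) (c i) 1 *
          risingFactorial (θ + α) (∑ j, c (i.succAbove j)) 1 / risingFactorial (θ + 1) (∑ i, c i) 1 *
          pitmanWeight α (θ + α) (fun j => c (i.succAbove j)) := by
        intro i
        rw [ih (by linarith) (by linarith) _ fun j => hc _,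
          ENNReal.toReal_ofReal (div_pos (mul_pos (hra _) (hr _)) (hr1 _)).le]
      rw [Finset.sum_congr rfl fun i _ => h2 i, add_sub_add_right_eq_sub, ← mul_sub, abs_mul,
        abs_of_pos (div_pos (hr _) (hr1 _))]
      gcongr
      exact risingFactorial_div_le_exp hα1 hθα hN
    set C := 1 + ∏ i, risingFactorial (1 - α) (c i - 1) 1 with hC
    have hbdd : ∀ θ, 0 ≤ θ → 0 < θ + α →
        |(stickMoment α θ c).toReal - pitmanWeight α θ c| ≤ C := by
      intro θ hθ hθα
      have h1 := pitmanWeight_nonneg hα0 hα1 hθα c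
      have h2 := pitmanWeight_le hα0 hα1 hθ hθα c hc
      have h3 : (stickMoment α θ c).toReal ≤ 1 := by
        simpa using ENNReal.toReal_mono ENNReal.one_ne_top (stickMoment_le_one hα0 hα1 hθα c hc)
      have h4 : 0 ≤ (stickMoment α θ c).toReal := ENNReal.toReal_nonneg
      rw [abs_le]
      constructor <;> linarith
    have hiter : ∀ m : ℕ, |(stickMoment α θ c).toReal - pitmanWeight α θ c| ≤
        Real.exp (-∑ j ∈ Finset.range m, (1 - α) / (θ + j * α + 1)) *
          |(stickMoment α (θ + m * α) c).toReal - pitmanWeight α (θ + m * α) c| := by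
      intro m
      induction m with
      | zero => simp
      | succ m ihm =>
        have hmα : 0 ≤ m * α := by positivity
        have h1 := hstep (θ + m * α) (by linarith) (by linarith)
        rw [show θ + m * α + α = θ + (m + 1 : ℕ) * α by push_cast; ring] at h1
        rw [Finset.sum_range_succ, neg_add, Real.exp_add, mul_assoc]
        exact ihm.trans (by gcongr)
    have hlim : Tendsto (fun m : ℕ =>
        Real.exp (-∑ j ∈ Finset.range m, (1 - α) / (θ + j * α + 1)) * C) atTop (𝓝 0) := by
      have := (Real.tendsto_exp_neg_atTop_nhds_zero.comp
        (tendsto_sum_div_add_mul hα0 hα1 hθ)).mul_const C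
      simpa using this
    have hle : |(stickMoment α θ c).toReal - pitmanWeight α θ c| ≤ 0 := by
      refine ge_of_tendsto' hlim fun m => (hiter m).trans ?_
      have hmα : 0 ≤ m * α := by positivity
      gcongr
      exact hbdd _ (by linarith) (by linarith)
    exact sub_eq_zero.1 (abs_nonpos_iff.1 hle)

end GEM

/-! ### The Fréchet race -/

lemma ae_expMeasure_pos {r : ℝ} (hr : 0 < r) : ∀ᵐ u ∂(expMeasure r), 0 < u := by
  have := isProbabilityMeasure_expMeasure hr
  rw [ae_iff]
  have h := cdf_expMeasure_eq hr 0
  have h0 : {u : ℝ | ¬ 0 < u} = Set.Iic 0 := by ext; simp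
  rw [cdf_eq_real] at h
  rw [h0, ← measureReal_eq_zero_iff]
  simpa using h

lemma expMeasure_Ioi {r x : ℝ} (hr : 0 < r) (hx : 0 ≤ x) :
    expMeasure r (Set.Ioi x) = ENNReal.ofReal (Real.exp (-(r * x))) := by
  have := isProbabilityMeasure_expMeasure hr
  have h := cdf_expMeasure_eq hr x
  rw [cdf_eq_real, if_pos hx] at h
  rw [← Set.compl_Iic, ← ENNReal.ofReal_toReal (measure_ne_top (expMeasure r) (Set.Iic x)ᶜ)]
  congr 1
  change (expMeasure r).real _ = _
  rw [probReal_compl_eq_one_sub measurableSet_Iic, h]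
  ring

instance (r : ℝ) : NullSingletonClass (expMeasure r) := by
  unfold expMeasure gammaMeasure
  infer_instance

/-- The Laplace transform of the exponential law. -/
lemma lintegral_expMeasure {r a : ℝ} (hr : 0 < r) (ha : 0 ≤ a) :
    ∫⁻ u, ENNReal.ofReal (Real.exp (-(a * u))) ∂(expMeasure r) = ENNReal.ofReal (r / (r + a)) := by
  have hmeas : Measurable (gammaPDF 1 r) := (measurable_gammaPDFReal 1 r).ennreal_ofReal
  unfold expMeasure gammaMeasure
  have hra : 0 < r + a := by linarith
  have hmeas' : Measurable (gammaPDF 1 (r + a)) := (measurable_gammaPDFReal 1 _).ennreal_ofReal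
  have h : ∀ x, (gammaPDF 1 r * fun u => ENNReal.ofReal (Real.exp (-(a * u)))) x =
      ENNReal.ofReal (r / (r + a)) * gammaPDF 1 (r + a) x := by
    intro x
    rw [Pi.mul_apply, gammaPDF_eq, gammaPDF_eq]
    split_ifs with hx
    · rw [← ENNReal.ofReal_mul' (by positivity), ← ENNReal.ofReal_mul (by positivity)]
      congr 1
      rw [show -((r + a) * x) = -(r * x) + -(a * x) by ring, Real.exp_add, Real.rpow_one,
        Real.rpow_one]
      field_simp
    · simp
  rw [lintegral_withDensity_eq_lintegral_mul _ hmeas (by fun_prop), lintegral_congr h,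
    lintegral_const_mul _ hmeas', lintegral_gammaPDF_eq_one one_pos hra, mul_one]

/-- The `1`-Fréchet law with scale `r`, as the law of the inverse of an exponential variable. -/
def frechetLaw (r : ℝ) : Measure ℝ := (expMeasure r).map (fun u => u⁻¹)

lemma frechetLaw_Iio {r x : ℝ} (hr : 0 < r) (hx : 0 < x) :
    frechetLaw r (Set.Iio x) = ENNReal.ofReal (Real.exp (-r / x)) := by
  rw [frechetLaw, Measure.map_apply measurable_inv measurableSet_Iio]
  have h : ((fun u : ℝ => u⁻¹) ⁻¹' Set.Iio x : Set ℝ) =ᵐ[expMeasure r] Set.Ioi x⁻¹ := by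
    filter_upwards [ae_expMeasure_pos hr] with u hu
    exact propext (inv_lt_comm₀ hu hx)
  rw [measure_congr h, expMeasure_Ioi hr (by positivity)]
  congr 2
  ring

lemma frechetLaw_Iic {r x : ℝ} (hr : 0 < r) (hx : 0 < x) :
    frechetLaw r (Set.Iic x) = ENNReal.ofReal (Real.exp (-r / x)) := by
  rw [frechetLaw, Measure.map_apply measurable_inv measurableSet_Iic]
  have h : ((fun u : ℝ => u⁻¹) ⁻¹' Set.Iic x : Set ℝ) =ᵐ[expMeasure r] Set.Ici x⁻¹ := by
    filter_upwards [ae_expMeasure_pos hr] with u hu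
    exact propext (inv_le_comm₀ hu hx)
  rw [measure_congr h, ← measure_congr Ioi_ae_eq_Ici, expMeasure_Ioi hr (by positivity)]
  congr 2
  ring

/-- A `1`-Fréchet variable has no mass on `(-∞, 0]`, so its distribution function on `(0, ∞)`
determines its law. -/
lemma IsOneFrechet.map_eq {Ω : Type*} [MeasurableSpace Ω] {P : Measure Ω} [IsProbabilityMeasure P]
    {r : ℝ} (hr : 0 < r) {X : Ω → ℝ} (h : IsOneFrechet r X P) : P.map X = frechetLaw r := by
  have := isProbabilityMeasure_expMeasure hr
  have hP := Measure.isProbabilityMeasure_map (μ := P) h.1.aemeasurable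
  have hF : IsProbabilityMeasure (frechetLaw r) :=
    Measure.isProbabilityMeasure_map measurable_inv.aemeasurable
  have hpos : ∀ x, 0 < x → P.map X (Set.Iic x) = frechetLaw r (Set.Iic x) := by
    intro x hx
    rw [frechetLaw_Iic hr hx, ← h.2 x hx, Measure.map_apply h.1 measurableSet_Iic,
      ofReal_measureReal]
    rfl
  refine Measure.ext_of_Iic _ _ fun x => ?_
  rcases lt_or_ge 0 x with hx | hx
  · exact hpos x hx
  have hlim : Tendsto (fun ε : ℝ => ENNReal.ofReal (Real.exp (-r / ε))) (𝓝[>] 0) (𝓝 0) := by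
    have h1 : Tendsto (fun ε : ℝ => Real.exp (-(r * ε⁻¹))) (𝓝[>] 0) (𝓝 0) :=
      Real.tendsto_exp_neg_atTop_nhds_zero.comp (tendsto_inv_nhdsGT_zero.const_mul_atTop hr)
    have h2 := (ENNReal.continuous_ofReal.tendsto 0).comp h1
    rw [ENNReal.ofReal_zero] at h2
    refine h2.congr fun ε => ?_
    simp [div_eq_mul_inv]
  have hz : ∀ μ : Measure ℝ, (∀ y, 0 < y → μ (Set.Iic y) = frechetLaw r (Set.Iic y)) →
      μ (Set.Iic x) = 0 := by
    intro μ hμ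
    refine le_antisymm (ge_of_tendsto hlim ?_) (zero_le)
    filter_upwards [self_mem_nhdsWithin] with ε (hε : 0 < ε)
    rw [← frechetLaw_Iic hr hε, ← hμ ε hε]
    exact measure_mono (Set.Iic_subset_Iic.2 (hx.trans hε.le))
  rw [hz _ hpos, hz _ fun _ _ => rfl]

section Race

variable {Ω : Type*} [MeasurableSpace Ω] {P : Measure Ω} [IsProbabilityMeasure P]
  {r : ℝ} {Z : ℕ → Ω → ℝ} {j : ℕ → ℝ}

/-- The probability that the `ℓ`-th variable beats finitely many others. Conditionally on
`Z ℓ = u⁻¹` it is an exponential function of `u`, and `u` is exponentially distributed. -/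
lemma measure_forall_mem_lt (hr : 0 < r) (hZ : ∀ ℓ, IsOneFrechet r (Z ℓ) P) (hind : iIndepFun Z P)
    (hj : ∀ ℓ, 0 < j ℓ) (ℓ : ℕ) (S : Finset ℕ) (hS : ℓ ∉ S) :
    P {ω | ∀ m ∈ S, j m * Z m ω < j ℓ * Z ℓ ω} =
      ENNReal.ofReal (j ℓ) / (ENNReal.ofReal (j ℓ) + ∑ m ∈ S, ENNReal.ofReal (j m)) := by
  have hm : ∀ ℓ, Measurable (Z ℓ) := fun ℓ => (hZ ℓ).1
  have hexp := isProbabilityMeasure_expMeasure hr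
  have hdis : Disjoint {ℓ} S := Finset.disjoint_singleton_left.2 hS
  have hφ : Measurable fun x : ({ℓ} : Finset ℕ) → ℝ => x ⟨ℓ, Finset.mem_singleton_self ℓ⟩ :=
    measurable_pi_apply _
  have h1 := (hind.indepFun_finset {ℓ} S hdis hm).comp hφ measurable_id
  have h2 : P.map (fun ω => (Z ℓ ω, fun m : S => Z m ω)) =
      (frechetLaw r).prod (P.map fun ω (m : S) => Z m ω) := by
    rw [← (hZ ℓ).map_eq hr]
    exact (indepFun_iff_map_prod_eq_prod_map_map (by fun_prop) (by fun_prop)).1 h1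
  have hprob := Measure.isProbabilityMeasure_map (μ := P) (f := fun ω (m : S) => Z m ω)
    (by fun_prop)
  have hB : MeasurableSet {q : ℝ × (S → ℝ) | ∀ m : S, j m * q.2 m < j ℓ * q.1} := by
    rw [Set.ofPred_forall]
    exact MeasurableSet.iInter fun m => measurableSet_lt (by fun_prop) (by fun_prop)
  have h3 : {ω | ∀ m ∈ S, j m * Z m ω < j ℓ * Z ℓ ω} =
      (fun ω => (Z ℓ ω, fun m : S => Z m ω)) ⁻¹' {q | ∀ m : S, j m * q.2 m < j ℓ * q.1} := by
    ext ω; simp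
  rw [h3, ← Measure.map_apply (by fun_prop) hB, h2, Measure.prod_apply hB, frechetLaw,
    lintegral_map (measurable_measure_prodMk_left hB) measurable_inv]
  set a := ∑ m ∈ S, r * (j m / j ℓ) with ha
  have ha0 : 0 ≤ a := Finset.sum_nonneg fun m _ => by have := hj m; have := hj ℓ; positivity
  have h4 : ∀ᵐ u ∂(expMeasure r), (P.map fun ω (m : S) => Z m ω)
      (Prod.mk u⁻¹ ⁻¹' {q : ℝ × (S → ℝ) | ∀ m : S, j m * q.2 m < j ℓ * q.1}) =
      ENNReal.ofReal (Real.exp (-(a * u))) := by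
    filter_upwards [ae_expMeasure_pos hr] with u hu
    rw [Measure.map_apply (by fun_prop) (measurable_prodMk_left hB)]
    have h5 : (fun ω (m : S) => Z m ω) ⁻¹' (Prod.mk u⁻¹ ⁻¹' {q : ℝ × (S → ℝ) |
        ∀ m : S, j m * q.2 m < j ℓ * q.1}) = ⋂ m ∈ S, Z m ⁻¹' Set.Iio (j ℓ * u⁻¹ / j m) := by
      ext ω
      simp only [Set.mem_preimage, Set.mem_ofPred_eq, Subtype.forall, Set.mem_iInter, Set.mem_Iio]
      refine forall₂_congr fun m _ => ?_
      rw [lt_div_iff₀ (hj m), mul_comm (Z m ω)]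
    rw [h5, iIndepFun_iff_measure_inter_preimage_eq_mul.1 hind S fun m _ => measurableSet_Iio]
    have h6 : ∀ m, P (Z m ⁻¹' Set.Iio (j ℓ * u⁻¹ / j m)) =
        ENNReal.ofReal (Real.exp (-(r * (j m / j ℓ) * u))) := by
      intro m
      have hjm := hj m
      have hjl := hj ℓ
      rw [← Measure.map_apply (hm m) measurableSet_Iio, (hZ m).map_eq hr,
        frechetLaw_Iio hr (by positivity)]
      congr 2
      field_simp
    simp_rw [h6]
    rw [← ENNReal.ofReal_prod_of_nonneg fun _ _ => (Real.exp_pos _).le, ← Real.exp_sum, ha,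
      Finset.sum_neg_distrib, Finset.sum_mul]
  rw [lintegral_congr_ae h4, lintegral_expMeasure hr ha0, ← ENNReal.ofReal_sum_of_nonneg
    (fun m _ => (hj m).le), ← ENNReal.ofReal_add (hj ℓ).le (Finset.sum_nonneg fun m _ => (hj m).le),
    ← ENNReal.ofReal_div_of_pos]
  · congr 1
    rw [ha, ← Finset.mul_sum, ← Finset.sum_div]
    have := hj ℓ
    field_simp
  · exact add_pos_of_pos_of_nonneg (hj ℓ) (Finset.sum_nonneg fun m _ => (hj m).le)

/-- The probability that the `ℓ`-th variable beats all others. -/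
lemma measure_forall_lt (hr : 0 < r) (hZ : ∀ ℓ, IsOneFrechet r (Z ℓ) P) (hind : iIndepFun Z P)
    (hj : ∀ ℓ, 0 < j ℓ) (ℓ : ℕ) :
    P {ω | ∀ m, m ≠ ℓ → j m * Z m ω < j ℓ * Z ℓ ω} =
      ENNReal.ofReal (j ℓ) / ∑' m, ENNReal.ofReal (j m) := by
  have hm : ∀ ℓ, Measurable (Z ℓ) := fun ℓ => (hZ ℓ).1
  let A : ℕ → Set Ω := fun N => {ω | ∀ m ∈ (Finset.range N).erase ℓ, j m * Z m ω < j ℓ * Z ℓ ω}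
  have hA : ∀ N, MeasurableSet (A N) := by
    intro N
    have : A N = ⋂ m ∈ (Finset.range N).erase ℓ, {ω | j m * Z m ω < j ℓ * Z ℓ ω} := by
      ext ω; simp [A]
    rw [this]
    exact Finset.measurableSet_biInter _ fun m _ => measurableSet_lt (by fun_prop) (by fun_prop)
  have hanti : Antitone A := fun N N' hN ω hω m hm =>
    hω m (Finset.erase_subset_erase _ (Finset.range_subset_range.2 hN) hm)
  have hI : {ω | ∀ m, m ≠ ℓ → j m * Z m ω < j ℓ * Z ℓ ω} = ⋂ N, A N := by
    ext ω
    simp only [Set.mem_ofPred_eq, Set.mem_iInter, A, Finset.mem_erase, Finset.mem_range]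
    exact ⟨fun h N m hm => h m hm.1, fun h m hm => h (m + 1) m ⟨hm, Nat.lt_succ_self m⟩⟩
  have h1 := tendsto_measure_iInter_atTop (μ := P) (fun N => (hA N).nullMeasurableSet) hanti
    ⟨0, measure_ne_top _ _⟩
  rw [hI]
  refine tendsto_nhds_unique h1 ?_
  have h2 : Tendsto (fun N => ENNReal.ofReal (j ℓ) / ∑ m ∈ Finset.range N, ENNReal.ofReal (j m))
      atTop (𝓝 (ENNReal.ofReal (j ℓ) / ∑' m, ENNReal.ofReal (j m))) :=
    ENNReal.Tendsto.const_div (ENNReal.tendsto_nat_tsum _) (Or.inr ENNReal.ofReal_ne_top)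
  refine h2.congr' ?_
  filter_upwards [eventually_gt_atTop ℓ] with N hN
  rw [Function.comp_apply, measure_forall_mem_lt hr hZ hind hj ℓ _ (Finset.notMem_erase _ _),
    Finset.add_sum_erase _ (fun m => ENNReal.ofReal (j m)) (Finset.mem_range.2 hN)]

/-- Almost surely some variable strictly beats all others: the winning events are disjoint and their
probabilities `j ℓ / ∑ j` sum to `1`. -/
lemma ae_exists_forall_lt (hr : 0 < r) (hZ : ∀ ℓ, IsOneFrechet r (Z ℓ) P) (hind : iIndepFun Z P)
    (hj : ∀ ℓ, 0 < j ℓ) (hT : ∑' m, ENNReal.ofReal (j m) ≠ ∞) :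
    ∀ᵐ ω ∂P, ∃ ℓ, ∀ m, m ≠ ℓ → j m * Z m ω < j ℓ * Z ℓ ω := by
  have hm : ∀ ℓ, Measurable (Z ℓ) := fun ℓ => (hZ ℓ).1
  let A : ℕ → Set Ω := fun ℓ => {ω | ∀ m, m ≠ ℓ → j m * Z m ω < j ℓ * Z ℓ ω}
  have hA : ∀ ℓ, MeasurableSet (A ℓ) := by
    intro ℓ
    have : A ℓ = ⋂ m, ⋂ (_ : m ≠ ℓ), {ω | j m * Z m ω < j ℓ * Z ℓ ω} := by
      ext ω; simp [A]
    rw [this]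
    exact MeasurableSet.iInter fun m => MeasurableSet.iInter fun _ =>
      measurableSet_lt (by fun_prop) (by fun_prop)
  have hdis : Pairwise (Function.onFun Disjoint A) := by
    intro a b hab
    refine Set.disjoint_left.2 fun ω ha hb => ?_
    exact lt_asymm (ha b hab.symm) (hb a hab)
  have hT0 : ∑' m, ENNReal.ofReal (j m) ≠ 0 := by
    rw [Ne, ENNReal.tsum_eq_zero]
    intro h
    have := h 0
    rw [ENNReal.ofReal_eq_zero] at this
    exact absurd (hj 0) (not_lt.2 this)
  have h1 : P (⋃ ℓ, A ℓ) = 1 := by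
    rw [measure_iUnion hdis hA]
    simp_rw [A, measure_forall_lt hr hZ hind hj, div_eq_mul_inv]
    rw [ENNReal.tsum_mul_right, ENNReal.mul_inv_cancel hT0 hT]
  have h2 := (prob_compl_eq_zero_iff (MeasurableSet.iUnion hA)).2 h1
  rw [ae_iff]
  convert h2 using 2
  ext ω
  simp [A]

end Race

/-! ### Paintbox partitions and distinct-index sums -/

section Partition

variable {n : ℕ}

lemma part_levelPartition_eq_iff (x : Fin n → ℕ) (i j : Fin n) :
    (levelPartition x).part i = (levelPartition x).part j ↔ x i = x j := by
  rw [← Finpartition.mem_part_iff_part_eq_part _ (Finset.mem_univ i) (Finset.mem_univ j)]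
  unfold levelPartition
  let _ : DecidableRel (Setoid.ker x) := fun i j => inferInstanceAs (Decidable (x i = x j))
  exact (Finpartition.mem_part_ofSetoid_iff_rel (s := Setoid.ker x)).trans eq_comm

lemma parts_eq_image_part (π : Finpartition (Finset.univ : Finset (Fin n))) :
    π.parts = Finset.univ.image π.part := by
  ext b
  simp only [Finset.mem_image, Finset.mem_univ, true_and]
  constructor
  · intro hb
    obtain ⟨i, hi⟩ := π.nonempty_of_mem_parts hb
    exact ⟨i, π.part_eq_of_mem hb hi⟩
  · rintro ⟨i, rfl⟩
    exact π.part_mem.2 (Finset.mem_univ i)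

lemma levelPartition_eq_iff (x : Fin n → ℕ) (π : Finpartition (Finset.univ : Finset (Fin n))) :
    levelPartition x = π ↔ ∀ i j, x i = x j ↔ π.part i = π.part j := by
  constructor
  · rintro rfl i j
    exact (part_levelPartition_eq_iff x i j).symm
  · intro h
    have hpart : ∀ i, (levelPartition x).part i = π.part i := by
      intro i
      ext j
      rw [Finpartition.mem_part_iff_part_eq_part _ (Finset.mem_univ j) (Finset.mem_univ i),
        Finpartition.mem_part_iff_part_eq_part _ (Finset.mem_univ j) (Finset.mem_univ i),
        part_levelPartition_eq_iff, h]
    refine Finpartition.ext ?_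
    rw [parts_eq_image_part, parts_eq_image_part, funext hpart]

/-- The sizes of the blocks of `π`, listed in the order of an arbitrary enumeration. -/
def blockSizes (π : Finpartition (Finset.univ : Finset (Fin n))) (a : Fin π.parts.card) : ℕ :=
  (π.parts.equivFin.symm a).1.card

/-- The label of the block of `π` that contains `i`. -/
def blockIndex (π : Finpartition (Finset.univ : Finset (Fin n))) (i : Fin n) : Fin π.parts.card :=
  π.parts.equivFin ⟨π.part i, π.part_mem.2 (Finset.mem_univ i)⟩

variable (π : Finpartition (Finset.univ : Finset (Fin n)))

lemma blockIndex_eq_iff (i j : Fin n) : blockIndex π i = blockIndex π j ↔ π.part i = π.part j := by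
  simp [blockIndex]

lemma filter_blockIndex (a : Fin π.parts.card) :
    Finset.univ.filter (fun i => blockIndex π i = a) = (π.parts.equivFin.symm a).1 := by
  ext i
  simp only [Finset.mem_filter, Finset.mem_univ, true_and]
  rw [blockIndex, ← Equiv.eq_symm_apply, Subtype.ext_iff,
    π.part_eq_iff_mem (π.parts.equivFin.symm a).2]

lemma one_le_blockSizes (a : Fin π.parts.card) : 1 ≤ blockSizes π a :=
  Finset.card_pos.2 (π.nonempty_of_mem_parts (π.parts.equivFin.symm a).2)

lemma blockIndex_surjective : Function.Surjective (blockIndex π) := by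
  intro a
  obtain ⟨i, hi⟩ := π.nonempty_of_mem_parts (π.parts.equivFin.symm a).2
  rw [← filter_blockIndex] at hi
  exact ⟨i, (Finset.mem_filter.1 hi).2⟩

lemma sum_blockSizes : ∑ a, blockSizes π a = n := by
  have := π.sum_card_parts
  rw [Finset.card_univ, Fintype.card_fin] at this
  rw [← Finset.sum_coe_sort, ← π.parts.equivFin.symm.sum_comp] at this
  exact this

lemma one_le_card_parts (hn : 1 ≤ n) : 1 ≤ π.parts.card :=
  Finset.card_pos.2 ⟨π.part ⟨0, hn⟩, π.part_mem.2 (Finset.mem_univ _)⟩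

lemma pitmanFormula_eq (α θ : ℝ) : pitmanFormula α θ π = pitmanWeight α θ (blockSizes π) := by
  unfold pitmanFormula pitmanWeight
  rw [sum_blockSizes, ← Finset.prod_coe_sort, ← π.parts.equivFin.symm.prod_comp]
  rfl

/-- If each tuple `x` has mass `∏ i, s (x i)`, then the mass of the tuples whose level sets are the
blocks of `π` is the distinct-index sum for the block sizes of `π`: such a tuple is the same as a
tuple of distinct labels for the blocks. -/
lemma measure_levelPartition_eq {μ : Measure (Fin n → ℕ)} {s : ℕ → ℝ≥0∞}
    (hμ : ∀ x, μ {x} = ∏ i, s (x i)) :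
    μ {x | levelPartition x = π} = distinctSum s (blockSizes π) := by
  classical
  rw [← Measure.tsum_indicator_apply_singleton μ _ (MeasurableSet.of_discrete), distinctSum]
  have hinj : Function.Injective fun (e : Fin π.parts.card → ℕ) (i : Fin n) => e (blockIndex π i) :=
    (blockIndex_surjective π).injective_comp_right
  rw [← hinj.tsum_eq]
  · refine tsum_congr fun e => ?_
    have h1 : levelPartition (fun i => e (blockIndex π i)) = π ↔ Function.Injective e := by
      rw [levelPartition_eq_iff]
      constructor
      · intro h a b hab
        obtain ⟨i, rfl⟩ := blockIndex_surjective π a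
        obtain ⟨j, rfl⟩ := blockIndex_surjective π b
        rw [blockIndex_eq_iff]
        exact (h i j).1 hab
      · intro he i j
        rw [he.eq_iff, blockIndex_eq_iff]
    simp only [Set.indicator_apply, Set.mem_ofPred_eq, h1, hμ]
    congr 1
    rw [← Finset.prod_fiberwise Finset.univ (blockIndex π)]
    refine Finset.prod_congr rfl fun a _ => ?_
    rw [Finset.prod_congr rfl (g := fun _ => s (e a)), Finset.prod_const, filter_blockIndex]
    · rfl
    · intro i hi
      rw [(Finset.mem_filter.1 hi).2]
  · intro x hx
    have hx' : levelPartition x = π := by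
      by_contra h
      exact hx (Set.indicator_of_notMem (s := {x | levelPartition x = π}) h _)
    rw [levelPartition_eq_iff] at hx'
    obtain ⟨g, hg⟩ := (blockIndex_surjective π).hasRightInverse
    refine ⟨fun a => x (g a), ?_⟩
    funext i
    exact (hx' _ _).2 ((blockIndex_eq_iff π _ _).1 (hg _))

lemma weightLaw_singleton (s : ℕ → ℝ) (ℓ : ℕ) : weightLaw s {ℓ} = ENNReal.ofReal (s ℓ) := by
  unfold weightLaw
  rw [Measure.sum_apply _ (measurableSet_singleton ℓ), tsum_eq_single ℓ]
  · simp
  · intro m hm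
    simp [hm]

/-- For a subprobability `s`, the paintbox probability of `π` is the distinct-index sum for its
block sizes. -/
lemma paintboxProb_eq {s : ℕ → ℝ} (hs : ∑' ℓ, ENNReal.ofReal (s ℓ) ≤ 1) :
    paintboxProb s π = distinctSum (fun ℓ => ENNReal.ofReal (s ℓ)) (blockSizes π) := by
  have : IsFiniteMeasure (weightLaw s) := by
    refine ⟨lt_of_le_of_lt ?_ ENNReal.one_lt_top⟩
    simpa [weightLaw, Measure.sum_apply _ MeasurableSet.univ] using hs
  refine measure_levelPartition_eq π fun x => ?_
  rw [Measure.pi_singleton]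
  simp_rw [weightLaw_singleton]

/-- Pitman's formula for the Poisson–Dirichlet partition. -/
lemma pdPartitionProb_eq {α θ : ℝ} (hα0 : 0 ≤ α) (hα1 : α < 1) (hθ : 0 ≤ θ) (hθα : 0 < θ + α) :
    pdPartitionProb α θ π = ENNReal.ofReal (pitmanFormula α θ π) := by
  rw [pitmanFormula_eq, ← stickMoment_eq hα0 hα1 hθ hθα _ (one_le_blockSizes π)]
  refine lintegral_congr_ae ?_
  filter_upwards [ae_stickLaw_mem_Ioo hα0 hα1 hθα] with W hW
  exact paintboxProb_eq π (tsum_stickBreaking_le_one hW)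

end Partition

/-! ### The hitting partition given the points -/

/-- The least maximiser of `ℓ ↦ j ℓ * y ℓ` for `p = (j, y)`, or `0` if there is none. -/
def argmaxSeq (p : (ℕ → ℝ) × (ℕ → ℝ)) : ℕ := sInf {ℓ | ∀ m, p.1 m * p.2 m ≤ p.1 ℓ * p.2 ℓ}

lemma measurable_argmaxSeq : Measurable argmaxSeq := by
  have hmax : ∀ ℓ : ℕ, MeasurableSet {p : (ℕ → ℝ) × (ℕ → ℝ) | ∀ m, p.1 m * p.2 m ≤ p.1 ℓ * p.2 ℓ} := by
    intro ℓ
    rw [Set.ofPred_forall]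
    exact MeasurableSet.iInter fun m => measurableSet_le (by fun_prop) (by fun_prop)
  have hiff : ∀ (p : (ℕ → ℝ) × (ℕ → ℝ)) (ℓ : ℕ), argmaxSeq p = ℓ ↔
      ((∀ m, p.1 m * p.2 m ≤ p.1 ℓ * p.2 ℓ) ∧
        ∀ i < ℓ, ¬ ∀ m, p.1 m * p.2 m ≤ p.1 i * p.2 i) ∨
      (ℓ = 0 ∧ ∀ i, ¬ ∀ m, p.1 m * p.2 m ≤ p.1 i * p.2 i) := by
    intro p ℓ
    unfold argmaxSeq
    set S : Set ℕ := {ℓ | ∀ m, p.1 m * p.2 m ≤ p.1 ℓ * p.2 ℓ} with hS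
    change sInf S = ℓ ↔ (ℓ ∈ S ∧ ∀ i < ℓ, i ∉ S) ∨ (ℓ = 0 ∧ ∀ i, i ∉ S)
    constructor
    · rintro rfl
      rcases S.eq_empty_or_nonempty with h | h
      · right; simp [h]
      · exact Or.inl ⟨Nat.sInf_mem h, fun i hi => Nat.notMem_of_lt_sInf hi⟩
    · rintro (⟨h1, h2⟩ | ⟨rfl, h2⟩)
      · refine le_antisymm (Nat.sInf_le h1) ?_
        by_contra! h
        exact h2 _ h (Nat.sInf_mem ⟨ℓ, h1⟩)
      · rw [Set.eq_empty_of_forall_notMem h2, Nat.sInf_empty]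
  refine measurable_to_countable' fun ℓ => ?_
  have : argmaxSeq ⁻¹' {ℓ} = ({p | ∀ m, p.1 m * p.2 m ≤ p.1 ℓ * p.2 ℓ} ∩
      ⋂ i, ⋂ (_ : i < ℓ), {p | ∀ m, p.1 m * p.2 m ≤ p.1 i * p.2 i}ᶜ) ∪
      ({_p | ℓ = 0} ∩ ⋂ i, {p | ∀ m, p.1 m * p.2 m ≤ p.1 i * p.2 i}ᶜ) := by
    ext p
    simp only [Set.mem_preimage, Set.mem_singleton_iff, hiff]
    simp
  rw [this]
  refine MeasurableSet.union ((hmax ℓ).inter (MeasurableSet.iInter fun i =>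
    MeasurableSet.iInter fun _ => (hmax i).compl)) (MeasurableSet.inter (.const _)
    (MeasurableSet.iInter fun i => (hmax i).compl))

lemma argmaxSeq_eq_of_forall_lt {p : (ℕ → ℝ) × (ℕ → ℝ)} {ℓ : ℕ}
    (h : ∀ m, m ≠ ℓ → p.1 m * p.2 m < p.1 ℓ * p.2 ℓ) : argmaxSeq p = ℓ := by
  have : {i | ∀ m, p.1 m * p.2 m ≤ p.1 i * p.2 i} = {ℓ} := by
    ext i
    simp only [Set.mem_ofPred_eq, Set.mem_singleton_iff]
    constructor
    · intro hi
      by_contra hne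
      exact absurd (hi ℓ) (not_le.2 (h i hne))
    · rintro rfl m
      rcases eq_or_ne m i with rfl | hm
      · exact le_rfl
      · exact (h m hm).le
  rw [argmaxSeq, this]
  exact csInf_singleton ℓ

section FixedPoints

variable {Ω : Type*} [MeasurableSpace Ω] {P : Measure Ω} {n : ℕ} {Y : ℕ → Fin n → Ω → ℝ}

/-- The columns of an independent array are independent. -/
lemma iIndepFun_columns (hY : ∀ ℓ k, Measurable (Y ℓ k))
    (h : iIndepFun (fun p : ℕ × Fin n => Y p.1 p.2) P) :
    iIndepFun (fun (k : Fin n) ω (ℓ : ℕ) => Y ℓ k ω) P := by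
  have hP := h.isProbabilityMeasure
  have hprob : ∀ k ℓ, IsProbabilityMeasure (P.map (Y ℓ k)) := fun k ℓ =>
    Measure.isProbabilityMeasure_map (hY ℓ k).aemeasurable
  have h1 : iIndepFun (fun p : Fin n × ℕ => Y p.2 p.1) P :=
    h.precomp (g := Prod.swap) Prod.swap_injective
  have h2 := h1.map_fun_eq_infinitePi_map (fun p : Fin n × ℕ => hY p.2 p.1)
  have hcol : ∀ k, P.map (fun ω ℓ => Y ℓ k ω) = Measure.infinitePi fun ℓ => P.map (Y ℓ k) := by
    intro k
    have : iIndepFun (fun ℓ => Y ℓ k) P :=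
      h.precomp (g := fun ℓ : ℕ => (ℓ, k)) fun a b hab => (Prod.ext_iff.1 hab).1
    exact this.map_fun_eq_infinitePi_map fun ℓ => hY ℓ k
  rw [iIndepFun_iff_map_fun_eq_infinitePi_map (fun k => measurable_pi_lambda _ fun ℓ => hY ℓ k)]
  simp_rw [hcol]
  rw [← Measure.infinitePi_map_curry (fun k ℓ => P.map (Y ℓ k)), ← h2, Measure.map_map (by fun_prop)
    (measurable_pi_lambda _ fun p : Fin n × ℕ => hY p.2 p.1)]
  rfl

variable [IsProbabilityMeasure P] {σ : Fin n → ℝ} {j : ℕ → ℝ}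

/-- Given the points, the hitting partition is the paintbox partition whose weights are the
normalised points. -/
lemma measure_levelPartition_argmaxSeq (hσ : ∀ k, 0 < σ k)
    (hY : ∀ ℓ k, IsOneFrechet (σ k) (Y ℓ k) P)
    (hind : iIndepFun (fun p : ℕ × Fin n => Y p.1 p.2) P) (hj : ∀ ℓ, 0 < j ℓ)
    (hT : ∑' m, ENNReal.ofReal (j m) ≠ ∞) (π : Finpartition (Finset.univ : Finset (Fin n))) :
    P {ω | levelPartition (fun k => argmaxSeq (j, fun ℓ => Y ℓ k ω)) = π} =
      distinctSum (fun ℓ => (∑' m, ENNReal.ofReal (j m))⁻¹ * ENNReal.ofReal (j ℓ))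
        (blockSizes π) := by
  have hm : ∀ ℓ k, Measurable (Y ℓ k) := fun ℓ k => (hY ℓ k).1
  have hg : Measurable fun y : ℕ → ℝ => argmaxSeq (j, y) :=
    measurable_argmaxSeq.comp measurable_prodMk_left
  have hX : ∀ k, Measurable fun ω => argmaxSeq (j, fun ℓ => Y ℓ k ω) := fun k =>
    hg.comp (measurable_pi_lambda _ fun ℓ => hm ℓ k)
  have hXi : iIndepFun (fun k ω => argmaxSeq (j, fun ℓ => Y ℓ k ω)) P :=
    (iIndepFun_columns hm hind).comp (fun _ y => argmaxSeq (j, y)) fun _ => hg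
  have hcol : ∀ k, iIndepFun (fun ℓ => Y ℓ k) P := fun k =>
    hind.precomp (g := fun ℓ : ℕ => (ℓ, k)) fun a b hab => (Prod.ext_iff.1 hab).1
  have hlaw : ∀ k ℓ, P ((fun ω => argmaxSeq (j, fun ℓ => Y ℓ k ω)) ⁻¹' {ℓ}) =
      (∑' m, ENNReal.ofReal (j m))⁻¹ * ENNReal.ofReal (j ℓ) := by
    intro k ℓ
    rw [mul_comm, ← div_eq_mul_inv, ← measure_forall_lt (hσ k) (fun ℓ => hY ℓ k) (hcol k) hj ℓ]
    refine measure_congr ?_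
    filter_upwards [ae_exists_forall_lt (hσ k) (fun ℓ => hY ℓ k) (hcol k) hj hT] with ω hω
    obtain ⟨ℓ', hℓ'⟩ := hω
    refine propext ?_
    change argmaxSeq (j, fun ℓ => Y ℓ k ω) = ℓ ↔ ∀ m, m ≠ ℓ → j m * Y m k ω < j ℓ * Y ℓ k ω
    constructor
    · intro h
      rw [argmaxSeq_eq_of_forall_lt (p := (j, fun ℓ => Y ℓ k ω)) hℓ'] at h
      rwa [← h]
    · intro h
      exact argmaxSeq_eq_of_forall_lt (p := (j, fun ℓ => Y ℓ k ω)) h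
  have hX' : Measurable fun ω k => argmaxSeq (j, fun ℓ => Y ℓ k ω) := measurable_pi_lambda _ hX
  rw [← measure_levelPartition_eq π (μ := P.map fun ω k => argmaxSeq (j, fun ℓ => Y ℓ k ω)),
    Measure.map_apply hX' MeasurableSet.of_discrete]
  · rfl
  intro x
  rw [Measure.map_apply hX' (measurableSet_singleton x)]
  have h1 : (fun ω k => argmaxSeq (j, fun ℓ => Y ℓ k ω)) ⁻¹' {x} =
      ⋂ k ∈ Finset.univ, (fun ω => argmaxSeq (j, fun ℓ => Y ℓ k ω)) ⁻¹' {x k} := by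
    ext ω
    simp [funext_iff]
  rw [h1, iIndepFun_iff_measure_inter_preimage_eq_mul.1 hXi Finset.univ
    fun k _ => measurableSet_singleton _]
  simp_rw [hlaw]

end FixedPoints

section Model

variable {Ω : Type*} [MeasurableSpace Ω] {P : Measure Ω} {n : ℕ}
  {ν : Measure ℝ} {σ : Fin n → ℝ} {J : ℕ → Ω → ℝ} {Y : ℕ → Fin n → Ω → ℝ}

lemma IsSubFrechetModel.measurable_marks (h : IsSubFrechetModel ν σ J Y P) :
    Measurable fun ω (p : ℕ × Fin n) => Y p.1 p.2 ω :=
  measurable_pi_lambda _ fun p => (h.frechet p.1 p.2).1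

/-- If the intensity does not charge `(-∞, 0]`, almost surely all points are positive. -/
lemma IsPoissonEnumeration.ae_pos (h : IsPoissonEnumeration ν J P) (hν : ν (Set.Iic 0) = 0) :
    ∀ᵐ ω ∂P, ∀ ℓ, 0 < J ℓ ω := by
  have h1 := h.hasLaw_count (Set.Iic 0) measurableSet_Iic
  have h2 : poissonLaw 0 = Measure.dirac 0 := by
    have : poissonMeasure 0 = Measure.dirac 0 := by
      refine Measure.ext_of_singleton fun k => ?_
      rw [poissonMeasure_singleton]
      cases k <;> simp
    rw [poissonLaw, if_neg ENNReal.zero_ne_top, ENNReal.toNNReal_zero, this,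
      Measure.map_dirac' (Measurable.of_discrete)]
    simp
  have h3 : ∀ᵐ ω ∂P, pointCount J (Set.Iic 0) ω = 0 := by
    have : ∀ᵐ x ∂(P.map (pointCount J (Set.Iic 0))), x = 0 := by
      rw [h1.map_eq, hν, h2]
      simp
    exact ae_of_ae_map h1.aemeasurable this
  filter_upwards [h3] with ω hω ℓ
  by_contra hneg
  have := ENNReal.tsum_eq_zero.1 hω ℓ
  rw [Set.indicator_of_mem (by exact not_lt.1 hneg)] at this
  exact one_ne_zero this

variable [IsProbabilityMeasure P]

/-- Fubini for the independent points and marks. -/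
lemma IsSubFrechetModel.measure_eq_lintegral (h : IsSubFrechetModel ν σ J Y P)
    {B : Set ((ℕ → ℝ) × (ℕ × Fin n → ℝ))} (hB : MeasurableSet B) :
    P {ω | (fun ℓ => J ℓ ω, fun p => Y p.1 p.2 ω) ∈ B} =
      ∫⁻ ω, P {ω' | (fun ℓ => J ℓ ω, fun p => Y p.1 p.2 ω') ∈ B} ∂P := by
  have hJ : Measurable fun ω ℓ => J ℓ ω := measurable_pi_lambda _ h.poisson.measurable
  have hY := h.measurable_marks
  have h1 := (indepFun_iff_map_prod_eq_prod_map_map hJ.aemeasurable hY.aemeasurable).1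
    h.indep_points_marks
  have h2 : P {ω | (fun ℓ => J ℓ ω, fun p : ℕ × Fin n => Y p.1 p.2 ω) ∈ B} =
      P.map (fun ω => (fun ℓ => J ℓ ω, fun p : ℕ × Fin n => Y p.1 p.2 ω)) B := by
    rw [Measure.map_apply (hJ.prodMk hY) hB]
    rfl
  have := Measure.isProbabilityMeasure_map (μ := P) hY.aemeasurable
  rw [h2, h1, Measure.prod_apply hB, lintegral_map (measurable_measure_prodMk_left hB) hJ]
  refine lintegral_congr fun ω => ?_
  rw [Measure.map_apply hY (measurable_prodMk_left hB)]
  rfl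

lemma distinctSum_single (s : ℕ → ℝ≥0∞) : distinctSum s (fun _ : Fin 1 => 1) = ∑' ℓ, s ℓ := by
  have h := distinctSum_cons_add s 1 (Fin.elim0 : Fin 0 → ℕ)
  rw [distinctSum_of_isEmpty, Finset.univ_eq_empty, Finset.sum_empty, add_zero, one_mul] at h
  have hc : (Fin.cons 1 (Fin.elim0 : Fin 0 → ℕ) : Fin 1 → ℕ) = fun _ => 1 := by
    funext i
    fin_cases i
    rfl
  rw [hc] at h
  simpa using h

/-- The total mass is finite as soon as the normalised points have expected sum `1`: that sum is at
most `1`, and it is `0` where the total mass is infinite. -/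
lemma ae_totalMass_ne_top (hJ : ∀ ℓ, Measurable (J ℓ))
    (h : ∫⁻ ω, distinctSum (fun ℓ => (totalMass J ω)⁻¹ * ENNReal.ofReal (J ℓ ω))
      (fun _ : Fin 1 => 1) ∂P = 1) :
    ∀ᵐ ω ∂P, totalMass J ω ≠ ∞ := by
  have hmT := measurable_totalMass hJ
  have h1 : ∀ ω, distinctSum (fun ℓ => (totalMass J ω)⁻¹ * ENNReal.ofReal (J ℓ ω))
      (fun _ : Fin 1 => 1) = (totalMass J ω)⁻¹ * totalMass J ω := by
    intro ω
    rw [distinctSum_single, ENNReal.tsum_mul_left]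
    rfl
  simp_rw [h1] at h
  have h2 : (fun ω => (totalMass J ω)⁻¹ * totalMass J ω) =ᵐ[P] fun _ => 1 := by
    refine ae_eq_of_ae_le_of_lintegral_le (ae_of_all _ fun ω => ENNReal.inv_mul_le_one _) ?_
      (by fun_prop) ?_
    · rw [h]; exact ENNReal.one_ne_top
    · rw [h]; simp
  filter_upwards [h2] with ω hω htop
  simp [htop] at hω

/-- The hitting partition of a sub-Fréchet model is determined by the distinct-index sums of the
normalised points. -/
theorem IsSubFrechetModel.hitting (h : IsSubFrechetModel ν σ J Y P)
    (hpos : ∀ᵐ ω ∂P, ∀ ℓ, 0 < J ℓ ω) (hT : ∀ᵐ ω ∂P, totalMass J ω ≠ ∞) :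
    (∀ᵐ ω ∂P, ∀ k, ∃! ℓ, IsMaximizer J Y ω k ℓ) ∧
    ∀ π, P {ω | hittingPartition J Y ω = π} =
      ∫⁻ ω, distinctSum (fun ℓ => (totalMass J ω)⁻¹ * ENNReal.ofReal (J ℓ ω)) (blockSizes π) ∂P := by
  have hcol : ∀ k, iIndepFun (fun ℓ => Y ℓ k) P := fun k =>
    h.indep_marks.precomp (g := fun ℓ : ℕ => (ℓ, k)) fun a b hab => (Prod.ext_iff.1 hab).1
  constructor
  · let B : Set ((ℕ → ℝ) × (ℕ × Fin n → ℝ)) :=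
      {q | ∀ k, ∃ ℓ, ∀ m, m ≠ ℓ → q.1 m * q.2 (m, k) < q.1 ℓ * q.2 (ℓ, k)}
    have hB : MeasurableSet B := by
      have : B = ⋂ k, ⋃ ℓ, ⋂ m, ⋂ (_ : m ≠ ℓ),
          {q : (ℕ → ℝ) × (ℕ × Fin n → ℝ) | q.1 m * q.2 (m, k) < q.1 ℓ * q.2 (ℓ, k)} := by
        ext q; simp [B]
      rw [this]
      exact MeasurableSet.iInter fun k => MeasurableSet.iUnion fun ℓ => MeasurableSet.iInter fun m =>
        MeasurableSet.iInter fun _ => measurableSet_lt (by fun_prop) (by fun_prop)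
    have h0 := h.measure_eq_lintegral hB.compl
    rw [lintegral_congr_ae (g := fun _ => 0), lintegral_zero] at h0
    · have h1 : ∀ᵐ ω ∂P, (fun ℓ => J ℓ ω, fun p : ℕ × Fin n => Y p.1 p.2 ω) ∈ B := by
        rw [ae_iff]; exact h0
      filter_upwards [h1] with ω hω k
      obtain ⟨ℓ, hℓ⟩ := hω k
      refine ⟨ℓ, fun m => ?_, fun ℓ' hℓ' => ?_⟩
      · rcases eq_or_ne m ℓ with rfl | hm
        · exact le_rfl
        · exact (hℓ m hm).le
      · by_contra hne
        exact absurd (hℓ' ℓ) (not_le.2 (hℓ ℓ' hne))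
    · filter_upwards [hpos, hT] with ω hω hTω
      have h1 : ∀ᵐ ω' ∂P, ∀ k, ∃ ℓ, ∀ m, m ≠ ℓ → J m ω * Y m k ω' < J ℓ ω * Y ℓ k ω' :=
        ae_all_iff.2 fun k => ae_exists_forall_lt (h.scale_pos k) (fun ℓ => h.frechet ℓ k) (hcol k)
          hω hTω
      exact ae_iff.1 h1
  · intro π
    let B : Set ((ℕ → ℝ) × (ℕ × Fin n → ℝ)) :=
      {q | levelPartition (fun k => argmaxSeq (q.1, fun ℓ => q.2 (ℓ, k))) = π}
    have hB : MeasurableSet B := by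
      have hX : Measurable fun (q : (ℕ → ℝ) × (ℕ × Fin n → ℝ)) (k : Fin n) =>
          argmaxSeq (q.1, fun ℓ => q.2 (ℓ, k)) :=
        measurable_pi_lambda _ fun k => measurable_argmaxSeq.comp (by fun_prop)
      exact hX (MeasurableSet.of_discrete (s := {x : Fin n → ℕ | levelPartition x = π}))
    refine (h.measure_eq_lintegral hB).trans (lintegral_congr_ae ?_)
    filter_upwards [hpos, hT] with ω hω hTω
    exact measure_levelPartition_argmaxSeq h.scale_pos h.frechet h.indep_marks hω hTω π

/-- If the expected distinct-index sums of the normalised points are Ewens–Pitman weights, then the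
hitting partition is a Poisson–Dirichlet partition. -/
theorem IsSubFrechetModel.isPDPartition_hittingPartition (h : IsSubFrechetModel ν σ J Y P)
    (hn : 1 ≤ n) (hν : ν (Set.Iic 0) = 0) {α θ : ℝ} (hα0 : 0 ≤ α) (hα1 : α < 1) (hθ : 0 ≤ θ)
    (hθα : 0 < θ + α)
    (hD : (∀ᵐ ω ∂P, totalMass J ω ≠ 0) → ∀ {k : ℕ}, 1 ≤ k → ∀ c : Fin k → ℕ, (∀ i, 1 ≤ c i) →
      ∫⁻ ω, distinctSum (fun ℓ => (totalMass J ω)⁻¹ * ENNReal.ofReal (J ℓ ω)) c ∂P =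
        ENNReal.ofReal (pitmanWeight α θ c)) :
    (∀ᵐ ω ∂P, ∀ k, ∃! ℓ, IsMaximizer J Y ω k ℓ) ∧
    IsPDPartition α θ (hittingPartition J Y) P ∧
    ∀ π, P.real {ω | hittingPartition J Y ω = π} = pitmanFormula α θ π := by
  have hpos := h.poisson.ae_pos hν
  have hT0 : ∀ᵐ ω ∂P, totalMass J ω ≠ 0 := by
    filter_upwards [hpos] with ω hω h0
    have := ENNReal.tsum_eq_zero.1 h0 0
    rw [ENNReal.ofReal_eq_zero] at this
    exact absurd (hω 0) (not_lt.2 this)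
  -- the case of one block of size one has weight `1`
  have hT := ae_totalMass_ne_top h.poisson.measurable (by
    rw [hD hT0 le_rfl _ fun _ => le_rfl]
    simp [pitmanWeight])
  obtain ⟨h1, h2⟩ := h.hitting hpos hT
  have h3 : ∀ π, P {ω | hittingPartition J Y ω = π} = ENNReal.ofReal (pitmanFormula α θ π) := by
    intro π
    rw [h2, hD hT0 (one_le_card_parts π hn) _ (one_le_blockSizes π), pitmanFormula_eq]
  refine ⟨h1, fun π => ?_, fun π => ?_⟩
  · rw [h3, pdPartitionProb_eq π hα0 hα1 hθ hθα]
  · rw [measureReal_def, h3, ENNReal.toReal_ofReal]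
    rw [pitmanFormula_eq]
    exact pitmanWeight_nonneg hα0 hα1 hθα _

end Model

lemma stableLevyMeasure_Iic (α : ℝ) : stableLevyMeasure α (Set.Iic 0) = 0 := by
  refine withDensity_absolutelyContinuous _ _ ?_
  rw [Measure.restrict_apply measurableSet_Iic, Set.inter_comm, Set.Ioi_inter_Iic, Set.Ioc_self,
    measure_empty]

lemma gammaLevyMeasure_Iic (θ : ℝ) : gammaLevyMeasure θ (Set.Iic 0) = 0 := by
  refine withDensity_absolutelyContinuous _ _ ?_
  rw [Measure.restrict_apply measurableSet_Iic, Set.inter_comm, Set.Ioi_inter_Iic, Set.Ioc_self,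
    measure_empty]

end HittingPartition

end

theorem mainTheorem2 {Ω : Type*} [MeasurableSpace Ω] (P : Measure Ω) [IsProbabilityMeasure P]
    {n : ℕ} (hn : 1 ≤ n) (σ : Fin n → ℝ) (J : ℕ → Ω → ℝ) (Y : ℕ → Fin n → Ω → ℝ) :
    (∀ α : ℝ, 0 < α → α < 1 →
      HittingPartition.IsSubFrechetModel (HittingPartition.stableLevyMeasure α) σ J Y P →
        (∀ᵐ ω ∂P, ∀ k, ∃! ℓ, HittingPartition.IsMaximizer J Y ω k ℓ) ∧
        HittingPartition.IsPDPartition α 0 (HittingPartition.hittingPartition J Y) P ∧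
        ∀ π, P.real {ω | HittingPartition.hittingPartition J Y ω = π} =
          HittingPartition.pitmanFormula α 0 π) ∧
    (∀ θ : ℝ, 0 < θ →
      HittingPartition.IsSubFrechetModel (HittingPartition.gammaLevyMeasure θ) σ J Y P →
        (∀ᵐ ω ∂P, ∀ k, ∃! ℓ, HittingPartition.IsMaximizer J Y ω k ℓ) ∧
        HittingPartition.IsPDPartition 0 θ (HittingPartition.hittingPartition J Y) P ∧
        ∀ π, P.real {ω | HittingPartition.hittingPartition J Y ω = π} =
          HittingPartition.pitmanFormula 0 θ π) := by
  refine ⟨fun α h0 h1 h => ?_, fun θ h0 h => ?_⟩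
  · exact h.isPDPartition_hittingPartition hn (HittingPartition.stableLevyMeasure_Iic α) h0.le h1
      le_rfl (by linarith) fun hT _ hk c hc =>
        HittingPartition.lintegral_distinctSum_stable h0 h1 h.poisson hT hk c hc
  · exact h.isPDPartition_hittingPartition hn (HittingPartition.gammaLevyMeasure_Iic θ) le_rfl
      one_pos h0.le (by linarith) fun hT _ hk c hc =>
        HittingPartition.lintegral_distinctSum_gamma h0 h.poisson hT hk c hc
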